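/- **Notation.** $\hat f(\xi)=\int_{\mathbb R}f(x)e^{-ix\xi}\,dx$ denotes the Fourier transform in $x$ (extended to $L^2(\mathbb R)$ and to tempered distributions), $|\partial_x|^s$ is the Fourier multiplier with symbol $|\xi|^s$ and $\partial_x^s$ the one with symbol $(i\xi)^s$ (principal branch). $\mathrm{Ai}$ is the Airy function. For $M>0$ let $\Omega_M=\mathbb R\times[0,M]$ and $$m(\xi)=m_M(\xi)=1-\frac{i\xi|\xi|^{1/3}}{\mathrm{Ai}'(0)\,e^{i\pi\,\mathrm{sgn}(\xi)/3}}\int_0^{(i\xi)^{1/3}M}\mathrm{Ai}(z)\,dz .$$ For $a\ge 0$ and $f=f(x,y)$ on $\Omega_M$ put $$\|f\|_{Y_a}=\|y|\partial_x|^{1+\frac a2}f\|_{L^2}+\||\partial_x|^{\frac23+\frac a2}f\|_{L^2}+\||\partial_x|^{\frac13+\frac a2}\partial_yf\|_{L^2}+\||\partial_x|^{\frac a2}\partial_y^2f\|_{L^2}+\||\partial_x|^{\frac{1+a}2}y^{\frac12}\partial_yf\|_{L^2},$$ $$\|f\|_{X_a}=\|f\|_{L^2}+\||\partial_x|^{\frac1{18}}y^{\frac16}f\|_{L^2}+\|f\|_{Y_a},\qquad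 \|f\|_{X_0\cap X_\alpha}=\|f\|_{X_0}+\|f\|_{X_\alpha},$$ with $L^2=L^2(\Omega_M)$ and weak $y$-derivatives, and for $A$ on $\mathbb R$ $$\|A\|_{X_{\alpha,\infty}}=\||\partial_x|^{\frac56}A\|_{H^{\frac43+\frac\alpha2}(\mathbb R)}+\|A\|_{L^\infty(\mathbb R)} .$$ $\mathcal X_{\alpha,M}$ is the set of pairs $(\omega,A)$ with $\|\omega\|_{X_0\cap X_\alpha}+\|A\|_{X_{\alpha,\infty}}<\infty$ and $\omega|_{y=M}=\frac{\mathrm{Ai}(M\partial_x^{1/3})}{\mathrm{Ai}'(0)}\,\partial_x^{2/3}|\partial_x|A$ (trace in $L^2(\mathbb R)$). **Theorem.** There are absolute constants $M_0>0$ and $C>0$ such that for every $M\ge M_0$ one has $m(\xi)\neq0$ for all $\xi\in\mathbb R$, and for every $\alpha\in(0,\frac73]$ and every real-valued $F\in H^2(\mathbb R)$ there is a pair of real-valued functions $(\omega_0,A_0)\in\mathcal X_{\alpha,M}$ that solves $$y\partial_x\omega_0-\partial_y^2\omega_0=0\ \text{ on }\mathbb R\times[0,M],\qquad \partial_y\omega_0|_{y=0}=\partial_x|\partial_x|A_0,\qquad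 \int_0^M\omega_0(x,y)\,dy=A_0(x)+F(x),$$ where $\omega_0,\partial_x\omega_0,\partial_y\omega_0,\partial_y^2\omega_0$ exist classically and are continuous on $\mathbb R\times[0,M]$ (one-sided in $y$ at the two ends), the first equation holds pointwise, and the other two hold for almost every $x$. The solution is given by $$\hat A_0(\xi)=-\frac{\hat F(\xi)}{m(\xi)},\qquad \hat\omega_0(\xi,y)=-\frac{\mathrm{Ai}\big((i\xi)^{1/3}y\big)}{\mathrm{Ai}'(0)\,(i\xi)^{1/3}}\;\frac{i\xi|\xi|}{m(\xi)}\,\hat F(\xi)$$ for almost every $\xi$, for all $y\in[0,M]$, and it satisfies $$\|\omega_0\|_{X_0\cap X_\alpha}+\|A_0\|_{X_{\alpha,\infty}}\le C\,\|F\|_{H^2(\mathbb R)} .$$ -/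

import Mathlib

open MeasureTheory Set Filter Topology Complex
open scoped ENNReal FourierTransform SchwartzMap

noncomputable section

namespace TripleDeck

/-! ### The Airy function and the multiplier `m` -/

/-- The Airy function `Ai`, by its contour integral
`Ai z = (1 / 2πi) ∫ exp (t ^ 3 / 3 - z t) dt` along the vertical line `t = 1 + i s`
(the integrand decays there like `exp (-s ^ 2)`, so the integral converges absolutely for every
complex `z`). -/
def airyAi (z : ℂ) : ℂ :=
  (1 / (2 * Real.pi)) * ∫ s : ℝ, exp ((1 + s * I) ^ 3 / 3 - z * (1 + s * I))

/-- `Ai' 0`. -/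
def airyDerivZero : ℂ := deriv airyAi 0

/-- `(i ξ) ^ s`, principal branch: the Fourier symbol of `∂ₓ ^ s`. -/
def symbolD (s : ℝ) (ξ : ℝ) : ℂ := (I * ξ) ^ (s : ℂ)

/-- `p_M ξ = ∫₀^{(i ξ)^{1/3} M} Ai z dz`, the integral being along the segment. -/
def pM (M ξ : ℝ) : ℂ :=
  (symbolD (1 / 3) ξ * M) * ∫ t in (0 : ℝ)..1, airyAi (t * (symbolD (1 / 3) ξ * M))

/-- `m ξ = 1 - p_M ξ / (Ai' 0 * exp (i π sgn ξ / 3)) * i ξ |ξ| ^ (1/3)`. -/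
def multM (M ξ : ℝ) : ℂ :=
  1 - pM M ξ / (airyDerivZero * exp (Real.sign ξ * (Real.pi / 3) * I))
      * (I * ξ * ((|ξ| ^ (1 / 3 : ℝ) : ℝ) : ℂ))

/-! ### Fourier transforms

Mathlib's transform is `f̂ ξ = ∫ f x exp (-2πi x ξ) dx`, so the operator with symbol `σ ξ`
(with respect to `exp (i x ξ)`) multiplies it by `σ (2π ξ)`. -/

/-- The `L²` (Plancherel) Fourier transform of a real function on the line (`0` if the function is
not in `L²`). -/
def fourierL2 (f : ℝ → ℝ) : ℝ → ℂ :=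
  open Classical in
  if h : MemLp (fun x => (f x : ℂ)) 2 (volume : Measure ℝ) then
    ((𝓕 (h.toLp (fun x => (f x : ℂ))) : Lp ℂ 2 (volume : Measure ℝ)) : ℝ → ℂ)
  else 0

/-- The distributional Fourier transform of the bounded function `A` is, on the open set of
nonzero frequencies, the locally integrable function `a`. -/
def IsFourierOffZero (A : ℝ → ℝ) (a : ℝ → ℂ) : Prop :=
  MemLp A ∞ (volume : Measure ℝ) ∧ LocallyIntegrableOn a {0}ᶜ volume ∧
    ∀ ψ : 𝓢(ℝ, ℂ), HasCompactSupport (ψ : ℝ → ℂ) → (0 : ℝ) ∉ tsupport (ψ : ℝ → ℂ) →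
      ∫ x, (A x : ℂ) * (𝓕 ψ) x = ∫ ξ, a ξ * ψ ξ

/-- `g = σ(D) A` as an `L²` function, for a symbol `σ` that vanishes at frequency zero. -/
def IsMultiplier (σ : ℝ → ℂ) (A g : ℝ → ℝ) : Prop :=
  MemLp g 2 (volume : Measure ℝ) ∧ ∃ a : ℝ → ℂ, IsFourierOffZero A a ∧
    fourierL2 g =ᵐ[volume] fun ξ => σ (2 * Real.pi * ξ) * a ξ

/-! ### Norms on the line -/

/-- The norm of `H^s(ℝ)`, `s ≥ 0` (`∞` off `L²`). -/
def eNormH (s : ℝ) (f : ℝ → ℝ) : ℝ≥0∞ :=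
  ⨅ _ : MemLp f 2 (volume : Measure ℝ),
    (∫⁻ ξ : ℝ, ENNReal.ofReal ((1 + (2 * Real.pi * ξ) ^ 2) ^ s)
      * ‖fourierL2 f ξ‖ₑ ^ 2) ^ (1 / 2 : ℝ)

/-- The norm of `X_{α,∞}`: `‖|∂ₓ|^{5/6} A‖_{H^{4/3+α/2}} + ‖A‖_{L^∞}`. -/
def eNormXinf (α : ℝ) (A : ℝ → ℝ) : ℝ≥0∞ :=
  (⨅ a : ℝ → ℂ, ⨅ _ : IsFourierOffZero A a,
    (∫⁻ ξ : ℝ, ENNReal.ofReal ((1 + (2 * Real.pi * ξ) ^ 2) ^ (4 / 3 + α / 2)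
        * ((2 * Real.pi * |ξ|) ^ (5 / 6 : ℝ)) ^ 2) * ‖a ξ‖ₑ ^ 2) ^ (1 / 2 : ℝ))
  + eLpNorm A ∞ volume

/-! ### Norms on the strip `Ω_M = ℝ × [0, M]`

A function on the strip is written `f x y`; its values for `y` outside `[0, M]` play no role. -/

/-- The (open) strip. -/
def strip (M : ℝ) : Set (ℝ × ℝ) := univ ×ˢ Ioo 0 M

/-- `g` is the weak derivative `∂_y ^ j f` in the open strip. -/
def IsWeakDy (M : ℝ) (j : ℕ) (f g : ℝ → ℝ → ℝ) : Prop :=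
  LocallyIntegrableOn (Function.uncurry f) (strip M) volume ∧
  LocallyIntegrableOn (Function.uncurry g) (strip M) volume ∧
  ∀ φ : ℝ × ℝ → ℝ, ContDiff ℝ ((⊤ : ℕ∞) : WithTop ℕ∞) φ → HasCompactSupport φ → tsupport φ ⊆ strip M →
    ∫ p : ℝ × ℝ, f p.1 p.2 * iteratedDeriv j (fun t => φ (p.1, t)) p.2
      = (-1) ^ j * ∫ p : ℝ × ℝ, g p.1 p.2 * φ p

/-- `‖ |∂ₓ| ^ s y ^ k f ‖_{L²(Ω_M)}` for `f ∈ L²(Ω_M)`, computed by Plancherel in `x` (`∞` if `f`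
is not in `L²(Ω_M)`). -/
def eNormMult (M s k : ℝ) (f : ℝ → ℝ → ℝ) : ℝ≥0∞ :=
  ⨅ _ : MemLp (Function.uncurry f) 2 (volume.restrict (strip M)),
    (∫⁻ y in Ioo 0 M, ∫⁻ ξ : ℝ, ENNReal.ofReal (((2 * Real.pi * |ξ|) ^ s * y ^ k) ^ 2)
      * ‖fourierL2 (fun x => f x y) ξ‖ₑ ^ 2) ^ (1 / 2 : ℝ)

/-- `‖ |∂ₓ| ^ s y ^ k ∂_y ^ j f ‖_{L²(Ω_M)}` with the weak derivative `∂_y ^ j f ∈ L²(Ω_M)`, which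
is unique up to null sets (`∞` if there is none). -/
def eNormMultDy (M : ℝ) (j : ℕ) (s k : ℝ) (f : ℝ → ℝ → ℝ) : ℝ≥0∞ :=
  ⨅ g : ℝ → ℝ → ℝ, ⨅ _ : IsWeakDy M j f g, eNormMult M s k g

/-- The norm of `Y_a`. -/
def eNormY (M a : ℝ) (f : ℝ → ℝ → ℝ) : ℝ≥0∞ :=
  eNormMult M (1 + a / 2) 1 f + eNormMult M (2 / 3 + a / 2) 0 f
    + eNormMultDy M 1 (1 / 3 + a / 2) 0 f + eNormMultDy M 2 (a / 2) 0 f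
    + eNormMultDy M 1 ((1 + a) / 2) (1 / 2) f

/-- The norm of `X_a`. -/
def eNormX (M a : ℝ) (f : ℝ → ℝ → ℝ) : ℝ≥0∞ :=
  eLpNorm (Function.uncurry f) 2 (volume.restrict (strip M))
    + eNormMult M (1 / 18) (1 / 6) f + eNormY M a f

/-- The norm of `X_0 ∩ X_α`. It is finite exactly on that space: for `f ∈ X_0` the functions
`f`, `∂_y f`, `∂_y² f` all lie in `L²(Ω_M)`, so the conventions above lose nothing. -/
def eNormX0X (M α : ℝ) (f : ℝ → ℝ → ℝ) : ℝ≥0∞ := eNormX M 0 f + eNormX M α f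

/-- `g` is the trace of `f` on the line `y = y₀`, in the sense of `L²(ℝ)`. -/
def HasTrace (M : ℝ) (f : ℝ → ℝ → ℝ) (y₀ : ℝ) (g : ℝ → ℝ) : Prop :=
  ∃ h : ℝ → ℝ → ℝ,
    Function.uncurry h =ᵐ[volume.restrict (strip M)] Function.uncurry f ∧
    Tendsto (fun y => eLpNorm (fun x => h x y - g x) 2 (volume : Measure ℝ))
      (𝓝[Ioo 0 M] y₀) (𝓝 0)

/-- `(ω, A) ∈ 𝒳_{α,M}`: finite norm, and
`ω|_{y=M} = (Ai (M ∂ₓ^{1/3}) / Ai' 0) ∂ₓ^{2/3} |∂ₓ| A`. -/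
structure MemCalX (α M : ℝ) (ω : ℝ → ℝ → ℝ) (A : ℝ → ℝ) : Prop where
  norm_lt_top : eNormX0X M α ω + eNormXinf α A < ∞
  trace_top : ∃ g : ℝ → ℝ, HasTrace M ω M g ∧
    IsMultiplier
      (fun ξ => airyAi (M * symbolD (1 / 3) ξ) / airyDerivZero
        * symbolD (2 / 3) ξ * ((|ξ| : ℝ) : ℂ)) A g

/-! ### The linearized system -/

/-- `(ω, A)` is a classical solution on `ℝ × [0, M]` of
`y ∂ₓω - ∂_y²ω = 0`, `∂_yω|_{y=0} = ∂ₓ|∂ₓ|A`, `∫₀^M ω dy = A + F`: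
`ωx`, `ωy`, `ωyy` are the (continuous) derivatives, one-sided in `y` at `y = 0` and `y = M`. -/
def IsSolution (M : ℝ) (F : ℝ → ℝ) (ω : ℝ → ℝ → ℝ) (A : ℝ → ℝ) : Prop :=
  ∃ ωx ωy ωyy : ℝ → ℝ → ℝ,
    (ContinuousOn (Function.uncurry ω) (univ ×ˢ Icc 0 M) ∧
      ContinuousOn (Function.uncurry ωx) (univ ×ˢ Icc 0 M) ∧
      ContinuousOn (Function.uncurry ωy) (univ ×ˢ Icc 0 M) ∧
      ContinuousOn (Function.uncurry ωyy) (univ ×ˢ Icc 0 M)) ∧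
    (∀ x : ℝ, ∀ y ∈ Icc 0 M,
      HasDerivAt (fun x' => ω x' y) (ωx x y) x ∧
      HasDerivWithinAt (fun y' => ω x y') (ωy x y) (Icc 0 M) y ∧
      HasDerivWithinAt (fun y' => ωy x y') (ωyy x y) (Icc 0 M) y ∧
      y * ωx x y - ωyy x y = 0) ∧
    IsMultiplier (fun ξ => I * ξ * ((|ξ| : ℝ) : ℂ)) A (fun x => ωy x 0) ∧
    ∀ᵐ x : ℝ, ∫ y in (0 : ℝ)..M, ω x y = A x + F x

/-- `- (Ai ((iξ)^{1/3} y) / (Ai' 0 (iξ)^{1/3})) (iξ |ξ| / m ξ)`. -/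
def symbolOmega (M y ξ : ℝ) : ℂ :=
  -(airyAi (symbolD (1 / 3) ξ * y) / (airyDerivZero * symbolD (1 / 3) ξ)
    * (I * ξ * ((|ξ| : ℝ) : ℂ) / multM M ξ))

/-- The explicit form of the solution: `Â = - F̂ / m` and
`ω̂ (ξ, y) = - (Ai ((iξ)^{1/3} y) / (Ai' 0 (iξ)^{1/3})) (iξ |ξ| / m) F̂`. -/
structure IsExplicit (M : ℝ) (F : ℝ → ℝ) (ω : ℝ → ℝ → ℝ) (A : ℝ → ℝ) : Prop where
  memLp_A : MemLp A 2 (volume : Measure ℝ)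
  fourier_A : fourierL2 A =ᵐ[volume] fun ξ => - fourierL2 F ξ / multM M (2 * Real.pi * ξ)
  memLp_ω : ∀ y ∈ Icc 0 M, MemLp (fun x => ω x y) 2 (volume : Measure ℝ)
  fourier_ω : ∀ y ∈ Icc 0 M, fourierL2 (fun x => ω x y) =ᵐ[volume] fun ξ =>
    symbolOmega M y (2 * Real.pi * ξ) * fourierL2 F ξ

end TripleDeck

end

open TripleDeck

/-!
After a Fourier transform in `x` the system becomes, for each frequency `ξ`, the Airy equation
`ω̂'' = i ξ y ω̂` on `[0, M]`. With `c = (i ξ) ^ (1/3)`, the solution proportional to `Ai (c y)` is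
selected; the condition at `y = 0` fixes its size in terms of `Â`, and the integral condition
becomes `m(ξ) Â = -F̂`. The proof therefore consists of a lower bound for `m`, decay of `Ai` on the
rays `arg z = ± π / 6`, and the translation of pointwise bounds on symbols into the function spaces.

*Airy function.* All integrals `∫ t ^ n exp (t ^ 3 / 3 - z t) dt` along vertical lines are treated
together. Integrating a total derivative gives both the Airy equation and the independence of the
line (`airyInt_recurrence`, `airyInt_eq`); the line `Re t = √|z|` then yields exponential decay in
the sector `|arg z| ≤ π / 6` (`exists_norm_airyInt_le`). The case `n = -1` is a decaying primitive of
`-Ai`. On the half-line `Ai` is real and `Ai Ai'` increases to `0`, so neither `Ai` nor `Ai'`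
vanishes there (`airyAi_mul_airyInt_one_pos`); hence `Ai' 0 ≠ 0` and `∫₀^∞ Ai ≠ 0`. The exact values of
these two real numbers play no role.

*Multiplier.* Up to an error `O(M ^ (-4))`, uniform in `ξ`, one has
`m = 1 - k |ξ| ^ (4/3) exp (± i π / 6)` with `k` real and nonzero. The points
`k |ξ| ^ (4/3) exp (± i π / 6)` lie on a line at distance `1/2` from `1`, so for large `M` the quantity
`|m|` is bounded below by a multiple of `1 + |ξ| ^ (4/3)` (`exists_le_norm_multM`).

*Estimates.* With `r = |ξ| ^ (1/3)`, the symbol of `∂_y ^ j ω` is bounded by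
`r ^ (5 + j) / (1 + r ^ 4) * exp (-3 r y / 4)` (`exists_norm_fieldSymbol_le`). Every term of the norms of
`X_0` and `X_α` has the form `|ξ| ^ s y ^ k ∂_y ^ j ω`, and its exponents satisfy
`0 ≤ 3 s - k + j + 9/2 ≤ 10`, the upper bound being where `α ≤ 7/3` enters; a single weighted estimate
(`HasSymbolBound.lintegral_le`), with the `y`-integral over `(0, ∞)` computed by scaling, covers all
of them. The transforms are also dominated by `(1 + ξ²) ^ (2/3) |F̂| ∈ L¹`, which gives the classical
derivatives up to the boundary and identifies the inverse Fourier integrals with the `L²` transform.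
-/

open TripleDeck

namespace TripleDeck

/-! ### Contour integrals of Airy type -/

/-- The integrand `t ^ n * exp (t ^ 3 / 3 - z t)` of the contour integrals of Airy type. -/
noncomputable def airyKernel (n : ℤ) (z t : ℂ) : ℂ := t ^ n * exp (t ^ 3 / 3 - z * t)

/-- The contour integral of `airyKernel n z` along the line `Re t = σ`, normalised so that
`n = 0`, `σ = 1` is the Airy function; `n = -1` gives minus a primitive of `Ai`. -/
noncomputable def airyInt (n : ℤ) (σ : ℝ) (z : ℂ) : ℂ :=
  (1 / (2 * Real.pi)) * ∫ s : ℝ, airyKernel n z (σ + s * I)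

theorem airyAi_eq_airyInt : airyAi = airyInt 0 1 := by
  funext z
  simp [airyAi, airyInt, airyKernel]

theorem line_ne_zero {σ : ℝ} (hσ : 0 < σ) (s : ℝ) : (σ + s * I : ℂ) ≠ 0 := by
  intro h
  have := congrArg Complex.re h
  simp at this
  exact hσ.ne' this

theorem norm_exp_line (σ s : ℝ) (z : ℂ) :
    ‖exp ((σ + s * I : ℂ) ^ 3 / 3 - z * (σ + s * I))‖
      = Real.exp (σ ^ 3 / 3 - σ * s ^ 2 - z.re * σ + z.im * s) := by
  rw [Complex.norm_exp]
  congr 1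
  have : ((σ + s * I : ℂ) ^ 3 / 3 - z * (σ + s * I))
      = ((σ ^ 3 / 3 - σ * s ^ 2 : ℝ) : ℂ) + ((σ ^ 2 * s - s ^ 3 / 3 : ℝ) : ℂ) * I
        - z * (σ + s * I) := by
    push_cast
    linear_combination (σ * s ^ 2 + s ^ 3 / 3 * I) * Complex.I_sq
  rw [this]
  simp only [sub_re, add_re, mul_re, ofReal_re, ofReal_im, I_re, I_im, add_im, mul_im]
  ring

theorem norm_zpow_le_exp {t : ℂ} (ht : t ≠ 0) (n : ℤ) :
    ‖t ^ n‖ ≤ Real.exp (|(n : ℝ)| * (‖t‖ + ‖t‖⁻¹)) := by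
  have h0 : 0 < ‖t‖ := norm_pos_iff.2 ht
  have h1 : |Real.log ‖t‖| ≤ ‖t‖ + ‖t‖⁻¹ := by
    have a := Real.log_le_sub_one_of_pos h0
    have b := Real.log_le_sub_one_of_pos (inv_pos.2 h0)
    rw [Real.log_inv] at b
    have := inv_pos.2 h0
    rw [abs_le]; constructor <;> linarith
  rw [norm_zpow, ← Real.rpow_intCast, Real.rpow_def_of_pos h0]
  refine Real.exp_le_exp.2 ?_
  calc Real.log ‖t‖ * n ≤ |Real.log ‖t‖ * n| := le_abs_self _
    _ = |(n : ℝ)| * |Real.log ‖t‖| := by rw [abs_mul, mul_comm]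
    _ ≤ _ := by gcongr

/-- A Gaussian majorant of the integrand, uniform for `σ` and `z` in compact sets. -/
theorem norm_airyKernel_le (n : ℤ) {a b R : ℝ} (ha : 0 < a) :
    ∃ K : ℝ, ∀ σ ∈ Icc a b, ∀ z : ℂ, ‖z‖ ≤ R → ∀ s : ℝ,
      ‖airyKernel n z (σ + s * I)‖ ≤ K * Real.exp (-(a / 2) * s ^ 2) := by
  refine ⟨Real.exp (|(n : ℝ)| * (b + a⁻¹) + b ^ 3 / 3 + R * b + (|(n : ℝ)| + R) ^ 2 / (2 * a)), ?_⟩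
  rintro σ ⟨h1, h2⟩ z hz s
  have hσ : 0 < σ := ha.trans_le h1
  have hR : 0 ≤ R := (norm_nonneg z).trans hz
  have ht := line_ne_zero hσ s
  have ht1 : ‖(σ + s * I : ℂ)‖ ≤ b + |s| := by
    refine (norm_add_le _ _).trans ?_
    simp only [norm_mul, norm_real, norm_I, mul_one, Real.norm_eq_abs]
    rw [abs_of_pos hσ]; linarith
  have ht2 : ‖(σ + s * I : ℂ)‖⁻¹ ≤ a⁻¹ := by
    refine inv_anti₀ ha (h1.trans ?_)
    have := Complex.abs_re_le_norm (σ + s * I : ℂ)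
    simp at this
    exact (le_abs_self σ).trans this
  rw [airyKernel, norm_mul, norm_exp_line, ← Real.exp_add]
  refine (mul_le_mul_of_nonneg_right (norm_zpow_le_exp ht n) (Real.exp_nonneg _)).trans ?_
  rw [← Real.exp_add]
  refine Real.exp_le_exp.2 ?_
  have e1 : |(n : ℝ)| * (‖(σ + s * I : ℂ)‖ + ‖(σ + s * I : ℂ)‖⁻¹) ≤ |(n : ℝ)| * (b + |s| + a⁻¹) := by
    gcongr
  have e2 : -(z.re * σ) ≤ R * b := by
    have := (abs_le.1 ((Complex.abs_re_le_norm z).trans hz)).1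
    nlinarith
  have e3 : z.im * s ≤ R * |s| := by
    calc z.im * s ≤ |z.im * s| := le_abs_self _
      _ = |z.im| * |s| := abs_mul _ _
      _ ≤ R * |s| := by gcongr; exact (Complex.abs_im_le_norm z).trans hz
  have e4 : σ ^ 3 / 3 ≤ b ^ 3 / 3 := by gcongr
  have e5 : a * s ^ 2 ≤ σ * s ^ 2 := by gcongr
  have e6 : (|(n : ℝ)| + R) * |s| ≤ a / 2 * s ^ 2 + (|(n : ℝ)| + R) ^ 2 / (2 * a) := by
    have : a / 2 * s ^ 2 + (|(n : ℝ)| + R) ^ 2 / (2 * a) - (|(n : ℝ)| + R) * |s|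
        = (a * |s| - (|(n : ℝ)| + R)) ^ 2 / (2 * a) := by
      rw [← sq_abs s]; field_simp; ring
    have : 0 ≤ (a * |s| - (|(n : ℝ)| + R)) ^ 2 / (2 * a) := by positivity
    linarith
  linarith

theorem hasDerivAt_airyKernel (n : ℤ) (z : ℂ) {t : ℂ} (ht : t ≠ 0) :
    HasDerivAt (airyKernel n z)
      (n * airyKernel (n - 1) z t + airyKernel (n + 2) z t - z * airyKernel n z t) t := by
  have h1 : HasDerivAt (fun t : ℂ => t ^ 3 / 3 - z * t) (t ^ 2 - z) t := by
    have := ((hasDerivAt_pow 3 t).div_const 3).sub ((hasDerivAt_id t).const_mul z)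
    convert! this using 1
    norm_num
  convert! (hasDerivAt_zpow n t (Or.inl ht)).mul h1.cexp using 1
  have e2 : t ^ (n + 2) = t ^ n * t ^ 2 := by
    rw [zpow_add₀ ht]; norm_cast
  simp only [airyKernel, e2]
  ring

theorem continuous_airyKernel_line (n : ℤ) (z : ℂ) {σ : ℝ} (hσ : 0 < σ) :
    Continuous fun s : ℝ => airyKernel n z (σ + s * I) := by
  have h : Continuous fun s : ℝ => (σ + s * I : ℂ) := by fun_prop
  exact continuous_iff_continuousAt.2 fun s =>
    (hasDerivAt_airyKernel n z (line_ne_zero hσ s)).continuousAt.comp'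
      (f := fun s : ℝ => (σ + s * I : ℂ)) h.continuousAt

theorem integrable_airyKernel_line (n : ℤ) (z : ℂ) {σ : ℝ} (hσ : 0 < σ) :
    Integrable fun s : ℝ => airyKernel n z (σ + s * I) := by
  obtain ⟨K, hK⟩ := norm_airyKernel_le n (b := σ) (R := ‖z‖) hσ
  refine ((integrable_exp_neg_mul_sq (half_pos hσ)).const_mul K).mono'
    (continuous_airyKernel_line n z hσ).aestronglyMeasurable (ae_of_all _ fun s => ?_)
  exact hK σ ⟨le_rfl, le_rfl⟩ z le_rfl s

theorem integral_airyKernel_line_combination (n : ℤ) (z : ℂ) {σ : ℝ} (hσ : 0 < σ) :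
    ∫ s : ℝ, (n * airyKernel (n - 1) z (σ + s * I) + airyKernel (n + 2) z (σ + s * I)
        - z * airyKernel n z (σ + s * I))
      = n * (∫ s : ℝ, airyKernel (n - 1) z (σ + s * I))
        + (∫ s : ℝ, airyKernel (n + 2) z (σ + s * I)) - z * ∫ s : ℝ, airyKernel n z (σ + s * I) := by
  have h1 := (integrable_airyKernel_line (n - 1) z hσ).const_mul (n : ℂ)
  have h2 := integrable_airyKernel_line (n + 2) z hσ
  have h3 := (integrable_airyKernel_line n z hσ).const_mul z
  rw [integral_sub (f := fun s : ℝ => n * airyKernel (n - 1) z (σ + s * I)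
      + airyKernel (n + 2) z (σ + s * I)) (h1.add h2) h3,
    integral_add h1 h2, integral_const_mul, integral_const_mul]

/-- The integral of a total derivative vanishes; for `n = 0` this is the Airy equation. -/
theorem airyInt_recurrence (n : ℤ) (z : ℂ) {σ : ℝ} (hσ : 0 < σ) :
    n * airyInt (n - 1) σ z + airyInt (n + 2) σ z - z * airyInt n σ z = 0 := by
  have hi := fun k : ℤ => integrable_airyKernel_line k z hσ
  have hd : ∀ s : ℝ, HasDerivAt (fun s : ℝ => airyKernel n z (σ + s * I))
      ((n * airyKernel (n - 1) z (σ + s * I) + airyKernel (n + 2) z (σ + s * I)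
        - z * airyKernel n z (σ + s * I)) * I) s := by
    intro s
    have h1 : HasDerivAt (fun s : ℝ => (σ + s * I : ℂ)) I s := by
      simpa using ((Complex.ofRealCLM.hasDerivAt (x := s)).mul_const I).const_add (σ : ℂ)
    exact (hasDerivAt_airyKernel n z (line_ne_zero hσ s)).comp s h1
  have h0 := integral_eq_zero_of_hasDerivAt_of_integrable hd
    (((((hi _).const_mul _).add (hi _)).sub ((hi _).const_mul _)).mul_const _) (hi n)
  rw [integral_mul_const, integral_airyKernel_line_combination n z hσ] at h0
  have h0' := (mul_eq_zero.1 h0).resolve_right I_ne_zero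
  simp only [airyInt]
  linear_combination (1 / (2 * Real.pi) : ℂ) * h0'

theorem hasDerivAt_airyInt (n : ℤ) {σ : ℝ} (hσ : 0 < σ) (z : ℂ) :
    HasDerivAt (airyInt n σ) (-airyInt (n + 1) σ z) z := by
  obtain ⟨K, hK⟩ := norm_airyKernel_le (n + 1) (b := σ) (R := ‖z‖ + 1) hσ
  have key := hasDerivAt_integral_of_dominated_loc_of_deriv_le (μ := volume) (𝕜 := ℂ)
    (F := fun w (s : ℝ) => airyKernel n w (σ + s * I))
    (F' := fun w (s : ℝ) => -airyKernel (n + 1) w (σ + s * I)) (x₀ := z)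
    (bound := fun s => K * Real.exp (-(σ / 2) * s ^ 2))
    (Metric.ball_mem_nhds z one_pos)
    (Eventually.of_forall fun w => (continuous_airyKernel_line n w hσ).aestronglyMeasurable)
    (integrable_airyKernel_line n z hσ)
    (continuous_airyKernel_line (n + 1) z hσ).aestronglyMeasurable.neg
    (ae_of_all _ fun s w hw => by
      rw [norm_neg]
      refine hK σ ⟨le_rfl, le_rfl⟩ w ?_ s
      have := norm_sub_norm_le w z
      rw [Metric.mem_ball, dist_eq_norm] at hw
      linarith)
    ((integrable_exp_neg_mul_sq (half_pos hσ)).const_mul K)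
    (ae_of_all _ fun s w _ => by
      have ht := line_ne_zero hσ s
      set t : ℂ := σ + s * I
      have h1 : HasDerivAt (fun w : ℂ => t ^ 3 / 3 - w * t) (-t) w := by
        simpa using ((hasDerivAt_id w).mul_const t).const_sub (t ^ 3 / 3)
      convert! h1.cexp.const_mul (t ^ n) using 1
      simp only [airyKernel, zpow_add_one₀ ht]
      ring)
  have := key.2.const_mul (1 / (2 * Real.pi) : ℂ)
  convert! this using 1
  simp [airyInt, integral_neg]

theorem hasDerivAt_airyInt_abscissa (n : ℤ) {σ : ℝ} (hσ : 0 < σ) (z : ℂ) :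
    HasDerivAt (fun σ => airyInt n σ z) 0 σ := by
  have hσ2 : 0 < σ / 2 := half_pos hσ
  obtain ⟨K1, hK1⟩ := norm_airyKernel_le (n - 1) (b := 2 * σ) (R := ‖z‖) hσ2
  obtain ⟨K2, hK2⟩ := norm_airyKernel_le (n + 2) (b := 2 * σ) (R := ‖z‖) hσ2
  obtain ⟨K3, hK3⟩ := norm_airyKernel_le n (b := 2 * σ) (R := ‖z‖) hσ2
  have hpos : ∀ {τ : ℝ}, τ ∈ Icc (σ / 2) (2 * σ) → 0 < τ := fun h => hσ2.trans_le h.1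
  have key := hasDerivAt_integral_of_dominated_loc_of_deriv_le (μ := volume) (𝕜 := ℝ)
    (F := fun (τ : ℝ) (s : ℝ) => airyKernel n z (τ + s * I))
    (F' := fun (τ : ℝ) (s : ℝ) => n * airyKernel (n - 1) z (τ + s * I)
      + airyKernel (n + 2) z (τ + s * I) - z * airyKernel n z (τ + s * I)) (x₀ := σ)
    (bound := fun s => (|(n : ℝ)| * K1 + K2 + ‖z‖ * K3) * Real.exp (-(σ / 2 / 2) * s ^ 2))
    (s := Icc (σ / 2) (2 * σ)) (Icc_mem_nhds (by linarith) (by linarith))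
    (eventually_of_mem (Icc_mem_nhds (by linarith) (by linarith))
      fun τ (hτ : τ ∈ Icc (σ / 2) (2 * σ)) =>
        (continuous_airyKernel_line n z (hpos hτ)).aestronglyMeasurable)
    (integrable_airyKernel_line n z hσ)
    (((continuous_const.mul (continuous_airyKernel_line (n - 1) z hσ)).add
      (continuous_airyKernel_line (n + 2) z hσ)).sub
        (continuous_const.mul (continuous_airyKernel_line n z hσ))).aestronglyMeasurable
    (ae_of_all _ fun s τ hτ => by
      refine (norm_sub_le _ _).trans ((add_le_add_left (norm_add_le _ _) _).trans ?_)
      rw [norm_mul, norm_mul, Complex.norm_intCast, add_mul, add_mul, mul_assoc, mul_assoc]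
      gcongr
      exacts [hK1 τ hτ z le_rfl s, hK2 τ hτ z le_rfl s, hK3 τ hτ z le_rfl s])
    ((integrable_exp_neg_mul_sq (half_pos hσ2)).const_mul _)
    (ae_of_all _ fun s τ hτ => by
      have h1 : HasDerivAt (fun τ : ℝ => (τ + s * I : ℂ)) 1 τ := by
        simpa using (Complex.ofRealCLM.hasDerivAt (x := τ)).add_const (s * I : ℂ)
      simpa using! (hasDerivAt_airyKernel n z (line_ne_zero (hpos hτ) s)).comp τ h1)
  have h2 := key.2.const_mul (1 / (2 * Real.pi) : ℂ)
  rw [integral_airyKernel_line_combination n z hσ] at h2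
  convert! h2 using 1
  have := airyInt_recurrence n z hσ
  simp only [airyInt] at this
  linear_combination -this

/-- The contour may be shifted horizontally. -/
theorem airyInt_eq (n : ℤ) {σ : ℝ} (hσ : 0 < σ) (z : ℂ) : airyInt n σ z = airyInt n 1 z := by
  refine isOpen_Ioi.is_const_of_deriv_eq_zero (𝕜 := ℝ) (f := fun σ => airyInt n σ z)
    (convex_Ioi (0 : ℝ)).isPreconnected ?_ ?_ hσ (mem_Ioi.2 one_pos)
  · exact fun τ hτ => (hasDerivAt_airyInt_abscissa n hτ z).differentiableAt.differentiableWithinAt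
  · exact fun τ hτ => (hasDerivAt_airyInt_abscissa n hτ z).deriv

theorem hasDerivAt_airyAi (z : ℂ) : HasDerivAt airyAi (-airyInt 1 1 z) z := by
  rw [airyAi_eq_airyInt]
  exact hasDerivAt_airyInt 0 one_pos z

theorem airyDerivZero_eq : airyDerivZero = -airyInt 1 1 0 := (hasDerivAt_airyAi 0).deriv

/-- The Airy equation `Ai'' = z Ai`. -/
theorem hasDerivAt_airyInt_one (z : ℂ) :
    HasDerivAt (airyInt 1 1) (-(z * airyAi z)) z := by
  have h := airyInt_recurrence 0 z one_pos
  simp only [Int.cast_zero, zero_mul, zero_add] at h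
  rw [airyAi_eq_airyInt, ← sub_eq_zero.1 h]
  exact hasDerivAt_airyInt 1 one_pos z

theorem hasDerivAt_airyInt_neg_one (z : ℂ) :
    HasDerivAt (airyInt (-1) 1) (-airyAi z) z := by
  rw [airyAi_eq_airyInt]
  exact hasDerivAt_airyInt (-1) one_pos z

theorem continuous_airyInt (n : ℤ) : Continuous (airyInt n 1) :=
  continuous_iff_continuousAt.2 fun z => (hasDerivAt_airyInt n one_pos z).continuousAt

theorem continuous_airyAi : Continuous airyAi := airyAi_eq_airyInt ▸ continuous_airyInt 0

theorem airyInt_conj (n : ℤ) (z : ℂ) :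
    airyInt n 1 (starRingEnd ℂ z) = starRingEnd ℂ (airyInt n 1 z) := by
  have h : ∀ s : ℝ, airyKernel n (starRingEnd ℂ z) ((1 : ℝ) + s * I)
      = starRingEnd ℂ (airyKernel n z ((1 : ℝ) + (-s : ℝ) * I)) := by
    intro s
    simp [airyKernel, ← Complex.exp_conj, map_ofNat]
  simp only [airyInt, h]
  rw [integral_conj, integral_neg_eq_self (fun s : ℝ => airyKernel n z ((1 : ℝ) + s * I))]
  simp [map_ofNat]

/-- The sector `|arg z| ≤ π / 6`, in a form with a little room. -/
def airySector : Set ℂ := {z | 0.86 * ‖z‖ ≤ z.re ∧ |z.im| ≤ ‖z‖ / 2}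

/-- Exponential decay in the sector, from the line `Re t = √|z|`. -/
theorem exists_norm_airyInt_le (n : ℤ) (hn : n ≤ 1) :
    ∃ K : ℝ, 0 < K ∧ ∀ z ∈ airySector, ‖airyInt n 1 z‖ ≤ K * Real.exp (-‖z‖) := by
  have hcompact : ∃ K₁ : ℝ, ∀ z ∈ Metric.closedBall (0 : ℂ) 1, ‖airyInt n 1 z‖ ≤ K₁ :=
    (isCompact_closedBall (0 : ℂ) 1).exists_bound_of_continuousOn (continuous_airyInt n).continuousOn
  obtain ⟨K₁, hK₁⟩ := hcompact
  set G : ℝ := ∫ s : ℝ, Real.exp (-(1 / 4) * s ^ 2) with hG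
  have hG0 : 0 ≤ G := integral_nonneg fun s => Real.exp_nonneg _
  refine ⟨|K₁| * Real.exp 1 + Real.exp 20 * G + 1, by positivity, fun z hz => ?_⟩
  rcases le_total ‖z‖ 1 with h1 | h1
  · have := hK₁ z (by simpa using h1)
    have e : 1 ≤ Real.exp 1 * Real.exp (-‖z‖) := by
      rw [← Real.exp_add]; exact Real.one_le_exp (by linarith)
    calc ‖airyInt n 1 z‖ ≤ |K₁| * 1 := by rw [mul_one]; exact this.trans (le_abs_self _)
      _ ≤ |K₁| * (Real.exp 1 * Real.exp (-‖z‖)) := by gcongr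
      _ = |K₁| * Real.exp 1 * Real.exp (-‖z‖) := by ring
      _ ≤ _ := by gcongr; nlinarith [Real.exp_pos 20]
  · obtain ⟨σ, hσ1, hσ⟩ : ∃ σ : ℝ, 1 ≤ σ ∧ ‖z‖ = σ ^ 2 :=
      ⟨√‖z‖, Real.one_le_sqrt.2 h1, (Real.sq_sqrt (norm_nonneg z)).symm⟩
    have hσ0 : 0 < σ := by linarith
    obtain ⟨hre, him⟩ := hz
    rw [hσ] at hre him ⊢
    rw [← airyInt_eq n hσ0]
    have hb : ∀ s : ℝ, ‖airyKernel n z (σ + s * I)‖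
        ≤ Real.exp 20 * Real.exp (-σ ^ 2) * Real.exp (-(1 / 4) * s ^ 2) := by
      intro s
      have ht1 : 1 ≤ ‖(σ + s * I : ℂ)‖ := by
        have := Complex.abs_re_le_norm (σ + s * I : ℂ)
        simp at this
        exact hσ1.trans ((le_abs_self σ).trans this)
      have ht2 : ‖(σ + s * I : ℂ)‖ ≤ σ + |s| := by
        refine (norm_add_le _ _).trans ?_
        simp only [norm_mul, norm_real, norm_I, mul_one, Real.norm_eq_abs]
        rw [abs_of_pos hσ0]
      have ht3 : ‖(σ + s * I : ℂ) ^ n‖ ≤ Real.exp (σ + |s|) := by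
        rw [norm_zpow]
        calc ‖(σ + s * I : ℂ)‖ ^ n ≤ ‖(σ + s * I : ℂ)‖ ^ (1 : ℤ) := zpow_le_zpow_right₀ ht1 hn
          _ ≤ σ + |s| := by simpa using ht2
          _ ≤ _ := by linarith [Real.add_one_le_exp (σ + |s|)]
      rw [airyKernel, norm_mul, norm_exp_line]
      refine (mul_le_mul_of_nonneg_right ht3 (Real.exp_nonneg _)).trans ?_
      rw [← Real.exp_add, ← Real.exp_add, ← Real.exp_add]
      refine Real.exp_le_exp.2 ?_
      have e1 : 0.86 * σ ^ 3 ≤ z.re * σ := by nlinarith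
      have e2 : z.im * s ≤ σ ^ 2 / 2 * |s| := by
        calc z.im * s ≤ |z.im * s| := le_abs_self _
          _ = |z.im| * |s| := abs_mul _ _
          _ ≤ _ := by gcongr
      have e3 : σ ^ 2 / 2 * |s| ≤ σ * s ^ 2 / 2 + σ ^ 3 / 8 := by
        rw [← sq_abs s]; nlinarith [mul_nonneg hσ0.le (sq_nonneg (|s| - σ / 2))]
      have e4 : |s| ≤ s ^ 2 / 4 + 1 := by
        rw [← sq_abs s]; nlinarith [sq_nonneg (|s| - 2)]
      have e5 : s ^ 2 / 2 ≤ σ * s ^ 2 / 2 := by nlinarith [sq_nonneg s]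
      -- The margin `0.86 - 1 / 3 - 1 / 8 > 0.4` in the cubic term absorbs all lower powers of `σ`.
      have e6 : σ ^ 2 + σ + 1 ≤ 20 + 0.4 * σ ^ 3 := by
        nlinarith [mul_nonneg hσ0.le (sq_nonneg (σ - 5 / 2)), sq_nonneg (σ - 5 / 2)]
      nlinarith [sq_nonneg σ]
    have hint : Integrable fun s : ℝ =>
        Real.exp 20 * Real.exp (-σ ^ 2) * Real.exp (-(1 / 4) * s ^ 2) :=
      (integrable_exp_neg_mul_sq (by norm_num : (0 : ℝ) < 1 / 4)).const_mul _
    have h2 := norm_integral_le_of_norm_le hint (ae_of_all _ hb)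
    rw [integral_const_mul] at h2
    have hpi : ‖(1 / (2 * Real.pi) : ℂ)‖ ≤ 1 := by
      have : (1 / (2 * Real.pi) : ℂ) = ((1 / (2 * Real.pi) : ℝ) : ℂ) := by push_cast; rfl
      rw [this, norm_real, Real.norm_of_nonneg (by positivity), div_le_one (by positivity)]
      linarith [Real.pi_gt_three]
    rw [airyInt, norm_mul]
    calc _ ≤ 1 * (Real.exp 20 * Real.exp (-σ ^ 2) * G) := by gcongr
      _ = Real.exp 20 * G * Real.exp (-σ ^ 2) := by ring
      _ ≤ _ := by
        gcongr
        nlinarith [mul_nonneg (abs_nonneg K₁) (Real.exp_nonneg 1)]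

/-! ### Nonvanishing of the Airy function on the positive half-line -/

theorem exists_airyAi_ofReal_ne_zero : ∃ x : ℝ, airyAi x ≠ 0 := by
  by_contra! h
  let q : ℝ → ℂ := fun s => airyKernel 0 0 ((1 : ℝ) + s * I)
  have hq : Integrable q := integrable_airyKernel_line 0 0 one_pos
  have hqc : Continuous q := continuous_airyKernel_line 0 0 one_pos
  have hF : 𝓕 q = 0 := by
    funext w
    have h1 := h (2 * Real.pi * w)
    rw [airyAi_eq_airyInt, airyInt] at h1
    have h2 := (mul_eq_zero.1 h1).resolve_left (by simp [Real.pi_ne_zero])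
    have h3 : ∀ s : ℝ, airyKernel 0 ((2 * Real.pi * w : ℝ) : ℂ) ((1 : ℝ) + s * I)
        = exp (-(2 * Real.pi * w : ℝ)) * (exp (↑(-2 * Real.pi * s * w) * I) • q s) := by
      intro s
      simp only [q, airyKernel, zpow_zero, one_mul, smul_eq_mul, ← Complex.exp_add]
      congr 1
      push_cast
      ring
    simp only [h3] at h2
    rw [integral_const_mul] at h2
    rw [Real.fourier_real_eq_integral_exp_smul]
    exact (mul_eq_zero.1 h2).resolve_left (exp_ne_zero _)
  have h0 := hqc.fourierInv_fourier_eq hq (by rw [hF]; exact integrable_zero _ _ _)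
  have h1 : q 0 = 0 := by
    rw [← h0, hF, Real.fourierInv_eq']
    simp
  simp [q, airyKernel] at h1

theorem ofReal_mem_airySector {x : ℝ} (hx : 0 ≤ x) : (x : ℂ) ∈ airySector := by
  constructor
  · simp only [norm_real, ofReal_re, Real.norm_of_nonneg hx]; linarith
  · simp only [norm_real, ofReal_im, abs_zero]; positivity

theorem airyInt_ofReal_im (n : ℤ) (x : ℝ) : (airyInt n 1 x).im = 0 := by
  have := airyInt_conj n (x : ℂ)
  rw [conj_ofReal] at this
  exact conj_eq_iff_im.1 this.symm

theorem airyInt_ofReal (n : ℤ) (x : ℝ) : airyInt n 1 x = ((airyInt n 1 x).re : ℂ) :=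
  Complex.ext rfl (by simp [airyInt_ofReal_im])

theorem tendsto_airyInt_atTop (n : ℤ) (hn : n ≤ 1) :
    Tendsto (fun x : ℝ => (airyInt n 1 x).re) atTop (𝓝 0) := by
  obtain ⟨K, -, hK⟩ := exists_norm_airyInt_le n hn
  have h : Tendsto (fun x : ℝ => K * Real.exp (-x)) atTop (𝓝 0) := by
    simpa using (Real.tendsto_exp_neg_atTop_nhds_zero).const_mul K
  refine squeeze_zero_norm' ((eventually_ge_atTop 0).mono fun x hx => ?_) h
  have := hK x (ofReal_mem_airySector hx)
  rw [norm_real, Real.norm_of_nonneg hx] at this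
  exact (Complex.abs_re_le_norm _).trans this

/-- `Ai` and `Ai'` have no zeros on `[0, ∞)`: the product `Ai Ai'` increases to zero there, since
its derivative is `Ai' ^ 2 + x Ai ^ 2`, and it cannot reach zero unless `Ai` vanishes on a
half-line, that is identically. -/
theorem airyAi_mul_airyInt_one_pos {x : ℝ} (hx : 0 ≤ x) :
    0 < (airyAi x).re * (airyInt 1 1 x).re := by
  have hd : ∀ x : ℝ, HasDerivAt (fun x : ℝ => (airyAi x).re * (airyInt 1 1 x).re)
      (-((airyInt 1 1 x).re ^ 2 + x * (airyAi x).re ^ 2)) x := by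
    intro x
    convert! (hasDerivAt_airyAi x).real_of_complex.mul
      (hasDerivAt_airyInt_one x).real_of_complex using 1
    simp only [neg_re, re_ofReal_mul]
    ring
  have hanti : AntitoneOn (fun x : ℝ => (airyAi x).re * (airyInt 1 1 x).re) (Ici 0) := by
    refine antitoneOn_of_deriv_nonpos (convex_Ici 0)
      (fun x _ => (hd x).continuousAt.continuousWithinAt)
      (fun x _ => (hd x).differentiableAt.differentiableWithinAt) fun x hx => ?_
    rw [interior_Ici, mem_Ioi] at hx
    rw [(hd x).deriv]
    have : 0 ≤ (airyInt 1 1 x).re ^ 2 + x * (airyAi x).re ^ 2 := by positivity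
    linarith
  have hlim : Tendsto (fun x : ℝ => (airyAi x).re * (airyInt 1 1 x).re) atTop (𝓝 0) := by
    rw [airyAi_eq_airyInt]
    simpa using (tendsto_airyInt_atTop 0 (by norm_num)).mul (tendsto_airyInt_atTop 1 le_rfl)
  have hnonneg : ∀ y : ℝ, 0 ≤ y → 0 ≤ (airyAi y).re * (airyInt 1 1 y).re := fun y hy =>
    le_of_tendsto hlim ((eventually_ge_atTop y).mono fun w hw => hanti hy (hy.trans hw) hw)
  refine lt_of_le_of_ne (hnonneg x hx) fun h0 => ?_
  have hz : ∀ y ∈ Ioi x, (airyAi y).re * (airyInt 1 1 y).re = 0 := fun y hy =>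
    le_antisymm (h0 ▸ hanti hx (hx.trans (le_of_lt hy)) (le_of_lt hy))
      (hnonneg y (hx.trans (le_of_lt hy)))
  have hf : ∀ y ∈ Ioi x, airyAi y = 0 := by
    intro y hy
    have hy0 : 0 < y := hx.trans_lt hy
    have h1 : HasDerivAt (fun x : ℝ => (airyAi x).re * (airyInt 1 1 x).re) 0 y :=
      (hasDerivAt_const y (0 : ℝ)).congr_of_eventuallyEq
        (eventually_of_mem (Ioi_mem_nhds hy) hz)
    have h2 := (hd y).unique h1
    have h3 : (airyAi y).re ^ 2 = 0 := by
      nlinarith [sq_nonneg (airyInt 1 1 y).re, sq_nonneg (airyAi y).re]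
    have h4 := airyInt_ofReal 0 y
    rw [← airyAi_eq_airyInt] at h4
    rw [h4, pow_eq_zero_iff two_ne_zero |>.1 h3, ofReal_zero]
  have han : AnalyticOnNhd ℂ airyAi univ :=
    Complex.analyticOnNhd_univ_iff_differentiable.2 fun z => (hasDerivAt_airyAi z).differentiableAt
  have hall := han.eqOn_zero_of_preconnected_of_frequently_eq_zero isPreconnected_univ
    (mem_univ ((x + 1 : ℝ) : ℂ)) (by
      have ht : Tendsto (fun y : ℝ => (y : ℂ)) (𝓝[>] (x + 1)) (𝓝[≠] ((x + 1 : ℝ) : ℂ)) := by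
        refine tendsto_nhdsWithin_iff.2 ⟨(continuous_ofReal.tendsto _).mono_left
          nhdsWithin_le_nhds, ?_⟩
        filter_upwards [self_mem_nhdsWithin] with y hy
        rw [mem_compl_singleton_iff, Ne, ofReal_inj]
        exact (ne_of_lt hy).symm
      refine ht.frequently (Eventually.frequently ?_)
      filter_upwards [self_mem_nhdsWithin] with y hy
      exact hf y (lt_trans (by linarith) (mem_Ioi.1 hy)))
  obtain ⟨y, hy⟩ := exists_airyAi_ofReal_ne_zero
  exact hy (hall (mem_univ _))

theorem airyAi_ofReal_re_ne_zero {x : ℝ} (hx : 0 ≤ x) : (airyAi x).re ≠ 0 :=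
  left_ne_zero_of_mul (airyAi_mul_airyInt_one_pos hx).ne'

theorem airyDerivZero_ne_zero : airyDerivZero ≠ 0 := by
  have h := right_ne_zero_of_mul (airyAi_mul_airyInt_one_pos le_rfl).ne'
  rw [airyDerivZero_eq, neg_ne_zero]
  intro h0
  rw [ofReal_zero, h0] at h
  simp at h

theorem pos_of_deriv_neg_of_tendsto_zero {g g' : ℝ → ℝ} (hd : ∀ x, HasDerivAt g (g' x) x)
    (hneg : ∀ x, 0 ≤ x → g' x < 0) (hlim : Tendsto g atTop (𝓝 0)) : 0 < g 0 := by
  have hanti : StrictAntiOn g (Ici 0) := by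
    refine strictAntiOn_of_deriv_neg (convex_Ici 0)
      (fun x _ => (hd x).continuousAt.continuousWithinAt) fun x hx => ?_
    rw [interior_Ici, mem_Ioi] at hx
    rw [(hd x).deriv]
    exact hneg x hx.le
  have h1 := hanti (mem_Ici.2 le_rfl) (mem_Ici.2 zero_le_one) one_pos
  refine lt_of_le_of_lt (le_of_tendsto hlim ((eventually_ge_atTop 1).mono fun w hw => ?_)) h1
  exact hanti.antitoneOn (mem_Ici.2 zero_le_one) (mem_Ici.2 (zero_le_one.trans hw)) hw

/-- The integral of `Ai` over the positive half-line does not vanish, because `Ai` has a constant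
sign there. -/
theorem airyInt_neg_one_zero_re_ne_zero : (airyInt (-1) 1 0).re ≠ 0 := by
  have hd : ∀ x : ℝ, HasDerivAt (fun x : ℝ => (airyInt (-1) 1 x).re) (-(airyAi x).re) x :=
    fun x => (hasDerivAt_airyInt_neg_one x).real_of_complex
  have hlim := tendsto_airyInt_atTop (-1) (by norm_num)
  have hc : ContinuousOn (fun x : ℝ => (airyAi x).re) (Ici 0) :=
    (Complex.continuous_re.comp (continuous_airyAi.comp continuous_ofReal)).continuousOn
  by_cases hpos : ∀ x : ℝ, 0 ≤ x → 0 < (airyAi x).re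
  · have := pos_of_deriv_neg_of_tendsto_zero hd (fun x hx => neg_neg_of_pos (hpos x hx)) hlim
    simpa using this.ne'
  · push Not at hpos
    obtain ⟨x₀, hx₀, h₀⟩ := hpos
    have hneg : ∀ x : ℝ, 0 ≤ x → (airyAi x).re < 0 := by
      intro x hx
      by_contra! h
      obtain ⟨c, hc0, hc1⟩ := (isPreconnected_Ici (a := (0 : ℝ))).intermediate_value
        (mem_Ici.2 hx₀) (mem_Ici.2 hx) hc ⟨h₀, h⟩
      exact airyAi_ofReal_re_ne_zero (mem_Ici.1 hc0) hc1
    have := pos_of_deriv_neg_of_tendsto_zero (fun x => (hd x).neg)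
      (fun x hx => by simpa using hneg x hx) (by simpa using! hlim.neg)
    have h2 : (airyInt (-1) 1 0).re < 0 := by simpa using this
    exact h2.ne

/-! ### The symbol `(i ξ) ^ s` -/

theorem symbolD_neg (s ξ : ℝ) : symbolD s (-ξ) = starRingEnd ℂ (symbolD s ξ) := by
  rcases eq_or_ne ξ 0 with rfl | hξ
  · by_cases hs : (s : ℂ) = 0
    · simp [symbolD, hs]
    · simp [symbolD, Complex.zero_cpow hs]
  · have harg : (I * ξ).arg ≠ Real.pi := by
      intro h
      have := (Complex.arg_eq_pi_iff.1 h).1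
      simp at this
    rw [symbolD, symbolD, ← Complex.conj_ofReal s, Complex.cpow_conj _ _ harg]
    simp

/-- Polar form of `(i ξ) ^ s`. -/
theorem symbolD_eq (s : ℝ) {ξ : ℝ} (hξ : ξ ≠ 0) :
    symbolD s ξ = ((|ξ| ^ s : ℝ) : ℂ) * exp ((Real.sign ξ * (Real.pi / 2) * s : ℝ) * I) := by
  have h0 : (I * ξ : ℂ) ≠ 0 := mul_ne_zero I_ne_zero (ofReal_ne_zero.2 hξ)
  have hl : Complex.log (I * ξ) = (Real.log |ξ| : ℂ) + ((Real.sign ξ * (Real.pi / 2) : ℝ) : ℂ) * I := by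
    rw [Complex.log]
    congr 1
    · simp
    · rcases lt_or_gt_of_ne hξ with h | h
      · have e : (I * ξ : ℂ) = ((-ξ : ℝ) : ℂ) * (-I) := by push_cast; ring
        rw [e, Complex.arg_real_mul _ (neg_pos.2 h), Complex.arg_neg_I, Real.sign_of_neg h,
          mul_comm]
        push_cast; ring
      · rw [mul_comm I (ξ : ℂ), Complex.arg_real_mul I h, Complex.arg_I, Real.sign_of_pos h]
        push_cast; ring
  rw [symbolD, Complex.cpow_def_of_ne_zero h0, hl, Real.rpow_def_of_pos (abs_pos.2 hξ),
    ofReal_exp, ← Complex.exp_add]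
  congr 1
  push_cast
  ring

theorem norm_symbolD (s : ℝ) {ξ : ℝ} (hξ : ξ ≠ 0) : ‖symbolD s ξ‖ = |ξ| ^ s := by
  rw [symbolD_eq s hξ, norm_mul, Complex.norm_exp_ofReal_mul_I, mul_one, norm_real,
    Real.norm_of_nonneg (by positivity)]

/-! ### The multiplier `m` -/

theorem symbolD_third_mul_mem_airySector (ξ : ℝ) {r : ℝ} (hr : 0 ≤ r) :
    symbolD (1 / 3) ξ * r ∈ airySector := by
  rcases eq_or_ne ξ 0 with rfl | hξ
  · simp [symbolD, airySector]
  have h3 : (0.86 : ℝ) ≤ √3 / 2 := by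
    have : (1.72 : ℝ) ≤ √3 := Real.le_sqrt_of_sq_le (by norm_num)
    linarith
  have hn : ‖symbolD (1 / 3) ξ * r‖ = |ξ| ^ (1 / 3 : ℝ) * r := by
    rw [norm_mul, norm_symbolD _ hξ, norm_real, Real.norm_of_nonneg hr]
  have hθ : Real.cos (Real.sign ξ * (Real.pi / 2) * (1 / 3)) = √3 / 2 ∧
      |Real.sin (Real.sign ξ * (Real.pi / 2) * (1 / 3))| = 1 / 2 := by
    have e : Real.pi / 2 * (1 / 3) = Real.pi / 6 := by ring
    rcases lt_or_gt_of_ne hξ with h | h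
    · rw [Real.sign_of_neg h, mul_assoc, e, neg_one_mul, Real.cos_neg, Real.sin_neg,
        Real.cos_pi_div_six, Real.sin_pi_div_six]
      norm_num
    · rw [Real.sign_of_pos h, mul_assoc, e, one_mul, Real.cos_pi_div_six, Real.sin_pi_div_six]
      norm_num
  have he : symbolD (1 / 3) ξ * r = ((|ξ| ^ (1 / 3 : ℝ) * r : ℝ) : ℂ)
      * exp ((Real.sign ξ * (Real.pi / 2) * (1 / 3) : ℝ) * I) := by
    rw [symbolD_eq _ hξ]; push_cast; ring
  have hρ : 0 ≤ |ξ| ^ (1 / 3 : ℝ) * r := by positivity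
  refine ⟨?_, ?_⟩
  · rw [hn, he, re_ofReal_mul, Complex.exp_ofReal_mul_I_re, hθ.1, mul_comm]
    gcongr
  · rw [hn, he, im_ofReal_mul, Complex.exp_ofReal_mul_I_im, abs_mul, hθ.2, abs_of_nonneg hρ]
    linarith

/-- `p_M` in terms of the decaying primitive of `-Ai`. -/
theorem pM_eq (M ξ : ℝ) :
    pM M ξ = airyInt (-1) 1 0 - airyInt (-1) 1 (symbolD (1 / 3) ξ * M) := by
  set z := symbolD (1 / 3) ξ * M with hz
  have hd : ∀ t ∈ uIcc (0 : ℝ) 1, HasDerivAt (fun t : ℝ => -airyInt (-1) 1 (t * z))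
      (z * airyAi (t * z)) t := by
    intro t _
    have h1 : HasDerivAt (fun t : ℝ => (t * z : ℂ)) z t := by
      simpa using (Complex.ofRealCLM.hasDerivAt (x := t)).mul_const z
    have := ((hasDerivAt_airyInt_neg_one (t * z)).comp t h1).neg
    convert! this using 1
    ring
  have hc : Continuous fun t : ℝ => z * airyAi (t * z) :=
    continuous_const.mul (continuous_airyAi.comp (by fun_prop))
  have h := intervalIntegral.integral_eq_sub_of_hasDerivAt hd (hc.intervalIntegrable 0 1)
  rw [intervalIntegral.integral_const_mul] at h
  rw [pM, ← hz, h]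
  simp
  ring

theorem multM_eq (M : ℝ) {ξ : ℝ} (hξ : ξ ≠ 0) :
    multM M ξ = 1 - pM M ξ / airyDerivZero
      * (((|ξ| ^ (4 / 3 : ℝ) : ℝ) : ℂ) * exp ((Real.sign ξ * (Real.pi / 6) : ℝ) * I)) := by
  have h1 : (I * ξ : ℂ) = ((|ξ| : ℝ) : ℂ) * exp ((Real.sign ξ * (Real.pi / 2) : ℝ) * I) := by
    have := symbolD_eq 1 hξ
    rw [symbolD, ofReal_one, cpow_one, mul_one, Real.rpow_one] at this
    exact this
  have h2 : exp ((Real.sign ξ * (Real.pi / 2) : ℝ) * I)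
      = exp (Real.sign ξ * (Real.pi / 3) * I) * exp ((Real.sign ξ * (Real.pi / 6) : ℝ) * I) := by
    rw [← Complex.exp_add]; congr 1; push_cast; ring
  have h3 : |ξ| ^ (4 / 3 : ℝ) = |ξ| * |ξ| ^ (1 / 3 : ℝ) := by
    rw [← Real.rpow_one_add' (abs_nonneg ξ) (by norm_num)]; norm_num
  rw [multM, h1, h2, h3]
  have := exp_ne_zero (Real.sign ξ * (Real.pi / 3) * I)
  have := airyDerivZero_ne_zero
  push_cast
  field_simp

/-- The line `ℝ exp (± i π / 6)` has distance `1/2` from `1`; the linear growth comes from the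
imaginary part. -/
theorem norm_one_sub_mul_exp_ge (u : ℝ) {ε : ℝ} (hε : ε = 1 ∨ ε = -1) :
    (1 + |u|) / 4 ≤ ‖1 - (u : ℂ) * exp ((ε * (Real.pi / 6) : ℝ) * I)‖ := by
  have hs : |Real.sin (ε * (Real.pi / 6))| = 1 / 2 := by
    rcases hε with rfl | rfl
    · rw [one_mul, Real.sin_pi_div_six]; norm_num
    · rw [neg_one_mul, Real.sin_neg, Real.sin_pi_div_six]; norm_num
  set θ := ε * (Real.pi / 6) with hθ
  have h1 : |u| / 2 ≤ ‖1 - (u : ℂ) * exp (θ * I)‖ := by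
    refine le_trans (le_of_eq ?_) (Complex.abs_im_le_norm _)
    rw [sub_im, one_im, im_ofReal_mul, Complex.exp_ofReal_mul_I_im, zero_sub, abs_neg, abs_mul, hs]
    ring
  have h2 : 1 / 2 ≤ ‖1 - (u : ℂ) * exp (θ * I)‖ := by
    have e : ‖1 - (u : ℂ) * exp (θ * I)‖ = ‖exp ((-θ : ℝ) * I) - u‖ := by
      rw [← one_mul ‖1 - (u : ℂ) * exp (θ * I)‖, ← Complex.norm_exp_ofReal_mul_I (-θ), ← norm_mul,
        mul_sub, mul_left_comm, ← Complex.exp_add]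
      congr 2
      · ring
      · push_cast; ring_nf; simp
    rw [e]
    refine le_trans (le_of_eq ?_) (Complex.abs_im_le_norm _)
    rw [sub_im, ofReal_im, Complex.exp_ofReal_mul_I_im, sub_zero, Real.sin_neg, abs_neg, hs]
  linarith

/-- Up to an error of size `M ^ (-4)`, the multiplier is `1 - k |ξ| ^ (4/3) exp (± i π / 6)` with
`k` real and nonzero, which stays away from zero. -/
theorem exists_le_norm_multM :
    ∃ M₀ : ℝ, 0 < M₀ ∧ ∃ c : ℝ, 0 < c ∧ ∀ M : ℝ, M₀ ≤ M → ∀ ξ : ℝ,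
      c * (1 + |ξ| ^ (4 / 3 : ℝ)) ≤ ‖multM M ξ‖ := by
  obtain ⟨K, hK0, hK⟩ := exists_norm_airyInt_le (-1) (by norm_num)
  set D := airyDerivZero with hD
  have hD0 : D ≠ 0 := airyDerivZero_ne_zero
  have hDn : 0 < ‖D‖ := norm_pos_iff.2 hD0
  obtain ⟨k, hk0, hk⟩ : ∃ k : ℝ, k ≠ 0 ∧ airyInt (-1) 1 0 / D = (k : ℂ) := by
    have h1 := airyInt_ofReal (-1) 0
    have h2 := airyInt_ofReal 1 0
    rw [ofReal_zero] at h1 h2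
    have h3 : D = ((-(airyInt 1 1 0).re : ℝ) : ℂ) := by
      rw [hD, airyDerivZero_eq, h2]; simp
    refine ⟨(airyInt (-1) 1 0).re / (-(airyInt 1 1 0).re),
      div_ne_zero airyInt_neg_one_zero_re_ne_zero fun h0 => hD0 (by rw [h3, h0, ofReal_zero]), ?_⟩
    rw [h3, ofReal_div, ← h1]
  refine ⟨max 1 (192 * K / ‖D‖), by positivity, min (1 / 8) (|k| / 4), by positivity,
    fun M hM ξ => ?_⟩
  have hM1 : 1 ≤ M := (le_max_left _ _).trans hM
  have hM2 : 192 * K / ‖D‖ ≤ M := (le_max_right _ _).trans hM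
  rcases eq_or_ne ξ 0 with rfl | hξ
  · have : min (1 / 8) (|k| / 4) ≤ 1 / 8 := min_le_left _ _
    have h0 : multM M 0 = 1 := by simp [multM]
    rw [h0, abs_zero, Real.zero_rpow (by norm_num), norm_one]
    linarith
  set r := |ξ| ^ (4 / 3 : ℝ) with hr
  have hr0 : 0 ≤ r := by positivity
  set z := symbolD (1 / 3) ξ * M with hz
  set B := airyInt (-1) 1 z with hB
  set e := exp ((Real.sign ξ * (Real.pi / 6) : ℝ) * I) with he
  have hen : ‖e‖ = 1 := Complex.norm_exp_ofReal_mul_I _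
  have hm : multM M ξ = (1 - ((k * r : ℝ) : ℂ) * e) + B / D * (r * e) := by
    rw [multM_eq M hξ, pM_eq, ← hz, ← hB, ← hD, ← hr, ← he, sub_div, hk]
    push_cast
    ring
  have hρ : ‖z‖ = |ξ| ^ (1 / 3 : ℝ) * M := by
    rw [hz, norm_mul, norm_symbolD _ hξ, norm_real, Real.norm_of_nonneg (by linarith)]
  have hBz := hK z (symbolD_third_mul_mem_airySector ξ (by linarith))
  -- `|ξ| ^ (4/3) = (|z| / M) ^ 4`, so the exponential decay of `B` in `|z|` makes the error `O(M ^ (-4))`.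
  have hr4 : r * M ^ 4 = ‖z‖ ^ 4 := by
    rw [hρ, mul_pow, ← Real.rpow_natCast (|ξ| ^ (1 / 3 : ℝ)), ← Real.rpow_mul (abs_nonneg ξ), hr]
    norm_num
  have hexp : ‖z‖ ^ 4 * Real.exp (-‖z‖) ≤ 24 := by
    have := Real.pow_div_factorial_le_exp ‖z‖ (norm_nonneg z) 4
    have h24 : ((Nat.factorial 4 : ℕ) : ℝ) = 24 := by norm_num [Nat.factorial]
    rw [h24, div_le_iff₀ (by norm_num)] at this
    rw [Real.exp_neg]
    rw [← div_eq_mul_inv, div_le_iff₀ (Real.exp_pos _)]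
    linarith
  have herr : ‖B / D * (r * e)‖ ≤ 1 / 8 := by
    rw [norm_mul, norm_div, norm_mul, hen, mul_one, norm_real, Real.norm_of_nonneg hr0]
    have h1 : r * ‖B‖ * M ^ 4 ≤ 24 * K := by
      calc r * ‖B‖ * M ^ 4 = (r * M ^ 4) * ‖B‖ := by ring
        _ ≤ ‖z‖ ^ 4 * (K * Real.exp (-‖z‖)) := by rw [hr4]; gcongr
        _ = K * (‖z‖ ^ 4 * Real.exp (-‖z‖)) := by ring
        _ ≤ K * 24 := by gcongr
        _ = _ := by ring
    have h2 : M ≤ M ^ 4 := le_self_pow₀ hM1 (by norm_num)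
    have h3 : 192 * K ≤ M * ‖D‖ := by rwa [div_le_iff₀ hDn] at hM2
    have h4 : r * ‖B‖ * M ≤ 24 * K := (by gcongr : r * ‖B‖ * M ≤ r * ‖B‖ * M ^ 4).trans h1
    rw [div_mul_eq_mul_div, div_le_iff₀ hDn]
    have h5 : M * (8 * (‖B‖ * r)) ≤ M * ‖D‖ := by linarith
    have := le_of_mul_le_mul_left h5 (by linarith)
    linarith
  have hsg : Real.sign ξ = 1 ∨ Real.sign ξ = -1 := by
    rcases lt_or_gt_of_ne hξ with h | h
    · exact Or.inr (Real.sign_of_neg h)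
    · exact Or.inl (Real.sign_of_pos h)
  have hmain := norm_one_sub_mul_exp_ge (k * r) hsg
  rw [abs_mul, abs_of_nonneg hr0] at hmain
  have htri : ‖1 - ((k * r : ℝ) : ℂ) * e‖ - ‖B / D * (r * e)‖ ≤ ‖multM M ξ‖ := by
    rw [hm]
    have := norm_sub_le ((1 - ((k * r : ℝ) : ℂ) * e) + B / D * (r * e)) (B / D * (r * e))
    rw [add_sub_cancel_right] at this
    linarith
  have hmin1 : min (1 / 8) (|k| / 4) ≤ 1 / 8 := min_le_left _ _
  have hmin2 : min (1 / 8) (|k| / 4) * r ≤ |k| / 4 * r := by gcongr; exact min_le_right _ _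
  linarith

theorem measurable_symbolD (s : ℝ) : Measurable (symbolD s) := by
  unfold symbolD; fun_prop

theorem measurable_multM (M : ℝ) : Measurable (multM M) := by
  have h1 : Measurable (pM M) := by
    have : pM M = fun ξ => airyInt (-1) 1 0 - airyInt (-1) 1 (symbolD (1 / 3) ξ * M) :=
      funext fun ξ => pM_eq M ξ
    rw [this]
    exact measurable_const.sub ((continuous_airyInt (-1)).measurable.comp
      ((measurable_symbolD _).mul_const _))
  have h2 : Measurable Real.sign := by
    unfold Real.sign
    exact Measurable.ite measurableSet_Iio measurable_const
      (Measurable.ite measurableSet_Ioi measurable_const measurable_const)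
  unfold multM
  fun_prop

theorem airyAi_conj (z : ℂ) : airyAi (starRingEnd ℂ z) = starRingEnd ℂ (airyAi z) := by
  rw [airyAi_eq_airyInt]; exact airyInt_conj 0 z

theorem airyDerivZero_conj : starRingEnd ℂ airyDerivZero = airyDerivZero := by
  rw [airyDerivZero_eq, map_neg, ← airyInt_conj, map_zero]

theorem multM_neg (M ξ : ℝ) : multM M (-ξ) = starRingEnd ℂ (multM M ξ) := by
  rw [multM, multM, pM_eq, pM_eq, symbolD_neg]
  have h1 := airyInt_conj (-1) (symbolD (1 / 3) ξ * M)
  have h0 := airyInt_conj (-1) 0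
  rw [map_mul, conj_ofReal] at h1
  rw [map_zero] at h0
  simp only [map_sub, map_mul, map_div₀, map_one, h1, ← h0, airyDerivZero_conj, ← Complex.exp_conj,
    conj_ofReal, conj_I, abs_neg, Real.sign_neg, ofReal_neg, map_ofNat]
  congr 1
  congr 2
  · ring_nf
  · ring

/-! ### Inverse Fourier integrals of integrable and square-integrable functions -/

theorem continuous_fourierInv {w : ℝ → ℂ} (hw : Integrable w) : Continuous (𝓕⁻ w : ℝ → ℂ) :=
  VectorFourier.fourierIntegral_continuous (L := -innerₗ ℝ) Real.continuous_fourierChar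
    (by simp only [LinearMap.neg_apply]; exact continuous_inner.neg) hw

theorem integral_fourierInv_mul {w φ : ℝ → ℂ} (hw : Integrable w) (hφ : Integrable φ) :
    ∫ x, (𝓕⁻ w : ℝ → ℂ) x * φ x = ∫ ξ, w ξ * (𝓕⁻ φ : ℝ → ℂ) ξ := by
  have h := VectorFourier.integral_fourierIntegral_smul_eq_flip (L := -innerₗ ℝ) (μ := volume)
    (ν := volume) (e := Real.fourierChar) Real.continuous_fourierChar
    (by simp only [LinearMap.neg_apply]; exact continuous_inner.neg) hw hφ
  have hL : (-innerₗ ℝ).flip = -innerₗ ℝ := by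
    ext; simp
  rw [hL] at h
  exact h

/-- On `L¹ ∩ L²` the inverse Fourier integral is the inverse Plancherel transform. -/
theorem fourierInv_ae_eq {w : ℝ → ℂ} (hw : Integrable w) (hw2 : MemLp w 2) :
    (𝓕⁻ w : ℝ → ℂ) =ᵐ[volume] ((𝓕⁻ (hw2.toLp w) : Lp ℂ 2 (volume : Measure ℝ)) : ℝ → ℂ) := by
  refine ae_eq_of_integral_contDiff_smul_eq (continuous_fourierInv hw).locallyIntegrable
    ((Lp.memLp _).locallyIntegrable (by norm_num)) fun g hg hgc => ?_
  have hgc' : HasCompactSupport fun x => (g x : ℂ) := hgc.comp_left (g := fun t : ℝ => (t : ℂ)) rfl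
  have hg' : ContDiff ℝ ((⊤ : ℕ∞) : WithTop ℕ∞) fun x => (g x : ℂ) :=
    Complex.ofRealCLM.contDiff.comp hg
  let φ : 𝓢(ℝ, ℂ) := hgc'.toSchwartzMap hg'
  have hφ : ∀ x, φ x = (g x : ℂ) := fun x => rfl
  have h1 : ∫ x, g x • (𝓕⁻ w : ℝ → ℂ) x = ∫ ξ, w ξ * (𝓕⁻ (φ : ℝ → ℂ) : ℝ → ℂ) ξ := by
    rw [← integral_fourierInv_mul hw φ.integrable]
    refine integral_congr_ae (ae_of_all _ fun x => ?_)
    simp only [hφ, real_smul, mul_comm]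
  have h2 : ∫ x, g x • ((𝓕⁻ (hw2.toLp w) : Lp ℂ 2 (volume : Measure ℝ)) : ℝ → ℂ) x
      = Lp.toTemperedDistribution (𝓕⁻ (hw2.toLp w) : Lp ℂ 2 (volume : Measure ℝ)) φ := by
    rw [Lp.toTemperedDistribution_apply]
    refine integral_congr_ae (ae_of_all _ fun x => ?_)
    simp only [hφ, real_smul, smul_eq_mul]
  rw [h1, h2, ← Lp.fourierInv_toTemperedDistribution_eq, TemperedDistribution.fourierInv_apply,
    Lp.toTemperedDistribution_apply]
  refine integral_congr_ae ?_
  filter_upwards [hw2.coeFn_toLp] with ξ hξ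
  rw [hξ, smul_eq_mul, mul_comm, SchwartzMap.fourierInv_coe]

theorem memLp_fourierInv {w : ℝ → ℂ} (hw : Integrable w) (hw2 : MemLp w 2) :
    MemLp (𝓕⁻ w : ℝ → ℂ) 2 :=
  (memLp_congr_ae (fourierInv_ae_eq hw hw2)).2 (Lp.memLp _)

theorem fourier_toLp_fourierInv {w : ℝ → ℂ} (hw : Integrable w) (hw2 : MemLp w 2) :
    𝓕 ((memLp_fourierInv hw hw2).toLp (𝓕⁻ w : ℝ → ℂ)) = hw2.toLp w := by
  have : (memLp_fourierInv hw hw2).toLp (𝓕⁻ w : ℝ → ℂ) = 𝓕⁻ (hw2.toLp w) := by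
    refine Lp.ext ?_
    filter_upwards [(memLp_fourierInv hw hw2).coeFn_toLp, fourierInv_ae_eq hw hw2] with x h1 h2
    rw [h1, h2]
  rw [this, FourierTransform.fourier_fourierInv_eq]

/-- Hermitian symmetry (almost everywhere), the property of the Fourier transforms of real-valued
functions. -/
def IsHermitianAE (w : ℝ → ℂ) : Prop := ∀ᵐ ξ : ℝ, w (-ξ) = starRingEnd ℂ (w ξ)

theorem conj_fourierInv (w : ℝ → ℂ) (x : ℝ) :
    starRingEnd ℂ ((𝓕⁻ w : ℝ → ℂ) x) = (𝓕⁻ (fun ξ => starRingEnd ℂ (w (-ξ))) : ℝ → ℂ) x := by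
  rw [Real.fourierInv_eq', Real.fourierInv_eq', ← integral_conj, ← integral_neg_eq_self]
  refine integral_congr_ae (ae_of_all _ fun ξ => ?_)
  simp [← Complex.exp_conj, map_ofNat]

/-- The real part of the inverse Fourier integral. -/
noncomputable def realInv (w : ℝ → ℂ) (x : ℝ) : ℝ := ((𝓕⁻ w : ℝ → ℂ) x).re

theorem ofReal_realInv {w : ℝ → ℂ} (hw : IsHermitianAE w) (x : ℝ) :
    (realInv w x : ℂ) = (𝓕⁻ w : ℝ → ℂ) x := by
  refine conj_eq_iff_re.1 ?_
  rw [conj_fourierInv, Real.fourierInv_eq', Real.fourierInv_eq']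
  refine integral_congr_ae ?_
  filter_upwards [hw] with ξ hξ
  rw [hξ, Complex.conj_conj]

theorem continuous_realInv {w : ℝ → ℂ} (hw : Integrable w) : Continuous (realInv w) :=
  Complex.continuous_re.comp (continuous_fourierInv hw)

theorem memLp_realInv {w : ℝ → ℂ} (hw : Integrable w) (hw2 : MemLp w 2) :
    MemLp (realInv w) 2 := (memLp_fourierInv hw hw2).re

theorem fourierL2_of_memLp {f : ℝ → ℝ} (hf : MemLp (fun x => (f x : ℂ)) 2) :
    fourierL2 f = ((𝓕 (hf.toLp (fun x => (f x : ℂ))) : Lp ℂ 2 (volume : Measure ℝ)) : ℝ → ℂ) :=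
  dif_pos hf

theorem fourierL2_realInv {w : ℝ → ℂ} (hw : Integrable w) (hw2 : MemLp w 2)
    (hh : IsHermitianAE w) : fourierL2 (realInv w) =ᵐ[volume] w := by
  have hf : MemLp (fun x => (realInv w x : ℂ)) 2 := (memLp_realInv hw hw2).ofReal
  rw [fourierL2_of_memLp hf]
  have : hf.toLp (fun x => (realInv w x : ℂ)) = (memLp_fourierInv hw hw2).toLp (𝓕⁻ w : ℝ → ℂ) :=
    (MemLp.toLp_eq_toLp_iff _ _).2 (ae_of_all _ fun x => ofReal_realInv hh x)
  rw [this, fourier_toLp_fourierInv hw hw2]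
  exact hw2.coeFn_toLp

theorem memLp_fourierL2 (f : ℝ → ℝ) : MemLp (fourierL2 f) 2 := by
  unfold fourierL2
  split_ifs with h
  · exact Lp.memLp _
  · exact MemLp.zero

theorem measurable_fourierL2 (f : ℝ → ℝ) : Measurable (fourierL2 f) := by
  unfold fourierL2
  split_ifs with h
  · exact (Lp.stronglyMeasurable _).measurable
  · exact measurable_zero

/-- Plancherel's identity. -/
theorem lintegral_enorm_fourierL2 {f : ℝ → ℝ} (hf : MemLp f 2) :
    ∫⁻ ξ, ‖fourierL2 f ξ‖ₑ ^ 2 = ∫⁻ x, ‖f x‖ₑ ^ 2 := by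
  have hf' : MemLp (fun x => (f x : ℂ)) 2 := hf.ofReal
  have key : eLpNorm (fourierL2 f) 2 volume = eLpNorm f 2 volume := by
    have h1 := Lp.norm_fourier_eq (hf'.toLp (fun x => (f x : ℂ)))
    rw [Lp.norm_def, Lp.norm_def, ENNReal.toReal_eq_toReal_iff' (Lp.eLpNorm_ne_top _)
      (Lp.eLpNorm_ne_top _), eLpNorm_congr_ae hf'.coeFn_toLp] at h1
    rw [fourierL2_of_memLp hf', h1]
    exact eLpNorm_congr_norm_ae (ae_of_all _ fun x => by simp)
  have e : ∀ {E : Type} [NormedAddCommGroup E] (g : ℝ → E),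
      eLpNorm g 2 volume ^ 2 = ∫⁻ x, ‖g x‖ₑ ^ 2 := by
    intro E _ g
    have := eLpNorm_nnreal_pow_eq_lintegral (μ := volume) (f := g) (p := 2) two_ne_zero
    simpa using! this
  rw [← e, ← e, key]

theorem ae_eq_realInv_fourierL2 {f : ℝ → ℝ} (hf : MemLp f 2) (hi : Integrable (fourierL2 f)) :
    (fun x => (f x : ℂ)) =ᵐ[volume] (𝓕⁻ (fourierL2 f) : ℝ → ℂ) := by
  have hf' : MemLp (fun x => (f x : ℂ)) 2 := hf.ofReal
  have h1 : (memLp_fourierL2 f).toLp (fourierL2 f) = 𝓕 (hf'.toLp (fun x => (f x : ℂ))) := by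
    refine Lp.ext ?_
    filter_upwards [(memLp_fourierL2 f).coeFn_toLp] with x hx
    rw [hx, fourierL2_of_memLp hf']
  have h2 := fourierInv_ae_eq hi (memLp_fourierL2 f)
  rw [h1, FourierTransform.fourierInv_fourier_eq] at h2
  filter_upwards [h2, hf'.coeFn_toLp] with x a b
  rw [a, b]

/-- The reflected conjugate of `F̂` has the same inverse transform as `F̂` because `F` is real. -/
theorem isHermitianAE_fourierL2 {f : ℝ → ℝ} (hf : MemLp f 2) (hi : Integrable (fourierL2 f)) :
    IsHermitianAE (fourierL2 f) := by
  let v : ℝ → ℂ := fun ξ => starRingEnd ℂ (fourierL2 f (-ξ))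
  have hv : Integrable v := by
    have := (Complex.conjCLE.toContinuousLinearMap.integrable_comp hi).comp_neg
    exact this
  have hv2 : MemLp v 2 := by
    have h1 : MemLp (fun ξ => fourierL2 f (-ξ)) 2 :=
      (memLp_fourierL2 f).comp_measurePreserving (Measure.measurePreserving_neg volume)
    exact h1.star
  have hF := ae_eq_realInv_fourierL2 hf hi
  have h1 : (𝓕⁻ v : ℝ → ℂ) =ᵐ[volume] (𝓕⁻ (fourierL2 f) : ℝ → ℂ) := by
    filter_upwards [hF] with x hx
    rw [← conj_fourierInv, ← hx, conj_ofReal]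
  have h2 : hv2.toLp v = (memLp_fourierL2 f).toLp (fourierL2 f) := by
    rw [← fourier_toLp_fourierInv hv hv2, ← fourier_toLp_fourierInv hi (memLp_fourierL2 f)]
    congr 1
    exact (MemLp.toLp_eq_toLp_iff _ _).2 h1
  have h3 := (MemLp.toLp_eq_toLp_iff _ _).1 h2
  filter_upwards [h3] with ξ hξ
  rw [← hξ, Complex.conj_conj]

theorem norm_realInv_le (w : ℝ → ℂ) (x : ℝ) : ‖realInv w x‖ ≤ ∫ ξ, ‖w ξ‖ :=
  (Complex.abs_re_le_norm _).trans
    (VectorFourier.norm_fourierIntegral_le_integral_norm Real.fourierChar volume (-innerₗ ℝ) w x)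

theorem isFourierOffZero_realInv {w : ℝ → ℂ} (hw : Integrable w) (hh : IsHermitianAE w) :
    IsFourierOffZero (realInv w) w := by
  refine ⟨?_, hw.locallyIntegrable.locallyIntegrableOn _, fun ψ _ _ => ?_⟩
  · exact memLp_top_of_bound (continuous_realInv hw).aestronglyMeasurable _
      (ae_of_all _ (norm_realInv_le w))
  · have h1 : Integrable (𝓕 (ψ : ℝ → ℂ) : ℝ → ℂ) := by
      rw [← SchwartzMap.fourier_coe]; exact (𝓕 ψ).integrable
    have h2 := integral_fourierInv_mul hw h1
    rw [ψ.continuous.fourierInv_fourier_eq ψ.integrable h1] at h2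
    rw [← h2]
    refine integral_congr_ae (ae_of_all _ fun x => ?_)
    simp only [ofReal_realInv hh, SchwartzMap.fourier_coe]

/-! ### Inverse Fourier integrals depending on a parameter -/

theorem realInv_eq (w : ℝ → ℂ) (x : ℝ) :
    realInv w x = (∫ ξ : ℝ, exp ((2 * Real.pi * (ξ * x) : ℝ) * I) * w ξ).re := by
  rw [realInv, Real.fourierInv_eq']
  simp only [smul_eq_mul, RCLike.inner_apply, conj_trivial, mul_comm x]

theorem continuous_realInv_param {W : ℝ → ℝ → ℂ} {D : ℝ → ℝ} (hD : Integrable D)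
    (hm : ∀ y, AEStronglyMeasurable (W y) volume) (hb : ∀ y, ∀ᵐ ξ, ‖W y ξ‖ ≤ D ξ)
    (hc : ∀ᵐ ξ, Continuous fun y => W y ξ) :
    Continuous (Function.uncurry fun x y => realInv (W y) x) := by
  have : (Function.uncurry fun x y => realInv (W y) x)
      = fun p : ℝ × ℝ => (∫ ξ : ℝ, exp ((2 * Real.pi * (ξ * p.1) : ℝ) * I) * W p.2 ξ).re := by
    funext p
    rw [← realInv_eq]; rfl
  rw [this]
  refine Complex.continuous_re.comp (continuous_of_dominated (bound := D) (fun p => ?_) (fun p => ?_)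
    hD ?_)
  · exact (Continuous.aestronglyMeasurable (by fun_prop)).mul (hm p.2)
  · filter_upwards [hb p.2] with ξ h
    rwa [norm_mul, Complex.norm_exp_ofReal_mul_I, one_mul]
  · filter_upwards [hc] with ξ h
    exact (by fun_prop : Continuous fun p : ℝ × ℝ => exp ((2 * Real.pi * (ξ * p.1) : ℝ) * I)).mul
      (h.comp continuous_snd)

theorem hasDerivAt_realInv {w : ℝ → ℂ} (hw : Integrable w)
    (hw' : Integrable fun ξ : ℝ => I * (2 * Real.pi * ξ : ℝ) * w ξ) (x : ℝ) :
    HasDerivAt (realInv w) (realInv (fun ξ : ℝ => I * (2 * Real.pi * ξ : ℝ) * w ξ) x) x := by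
  have hw2 : Integrable fun ξ : ℝ => ξ • w ξ := by
    refine (hw'.const_mul ((2 * Real.pi : ℂ)⁻¹ * -I)).congr (ae_of_all _ fun ξ => ?_)
    have : (Real.pi : ℂ) ≠ 0 := ofReal_ne_zero.2 Real.pi_ne_zero
    simp only [real_smul]
    push_cast
    field_simp
    linear_combination (-(ξ : ℂ) * w ξ) * I_sq
  have h1 := (Real.hasDerivAt_fourier hw hw2 (-x)).scomp x (hasDerivAt_neg x)
  have h2 : HasDerivAt (𝓕⁻ w : ℝ → ℂ)
      ((𝓕⁻ (fun ξ : ℝ => I * (2 * Real.pi * ξ : ℝ) * w ξ) : ℝ → ℂ) x) x := by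
    have e : ((𝓕 w : ℝ → ℂ) ∘ Neg.neg) = (𝓕⁻ w : ℝ → ℂ) := by
      funext t; rw [Function.comp_apply, ← Real.fourierInv_eq_fourier_neg]
    rw [← e]
    convert! h1 using 1
    rw [← Real.fourierInv_eq_fourier_neg, Real.fourierInv_eq', Real.fourierInv_eq', neg_smul, one_smul,
      ← integral_neg]
    refine integral_congr_ae (ae_of_all _ fun ξ => ?_)
    simp only [smul_eq_mul]
    push_cast
    ring
  exact (Complex.reCLM.hasFDerivAt.comp_hasDerivAt x h2)

theorem realInv_sub {v w : ℝ → ℂ} (hv : Integrable v) (hw : Integrable w) (x : ℝ) :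
    realInv (fun ξ => v ξ - w ξ) x = realInv v x - realInv w x := by
  have hi : ∀ {u : ℝ → ℂ}, Integrable u →
      Integrable fun ξ : ℝ => exp ((2 * Real.pi * (ξ * x) : ℝ) * I) * u ξ := fun hu =>
    hu.bdd_mul (c := 1) (Continuous.aestronglyMeasurable (by fun_prop))
      (ae_of_all _ fun ξ => (Complex.norm_exp_ofReal_mul_I _).le)
  simp only [realInv_eq, mul_sub]
  rw [integral_sub (hi hv) (hi hw), sub_re]

theorem realInv_const_mul (c : ℝ) (w : ℝ → ℂ) (x : ℝ) :
    realInv (fun ξ => c * w ξ) x = c * realInv w x := by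
  simp only [realInv_eq, mul_left_comm _ (c : ℂ)]
  rw [integral_const_mul, re_ofReal_mul]

/-- Differentiation under the integral relative to a convex set, as needed for the one-sided
derivatives at the ends of `[0, M]`. -/
theorem hasDerivWithinAt_realInv_param {W V : ℝ → ℝ → ℂ} {D : ℝ → ℝ} {s : Set ℝ} (hs : Convex ℝ s)
    (hD : Integrable D) (hi : ∀ y ∈ s, Integrable (W y))
    (hd : ∀ᵐ ξ, ∀ y ∈ s, HasDerivWithinAt (fun y => W y ξ) (V y ξ) s y)
    (hb : ∀ᵐ ξ, ∀ y ∈ s, ‖V y ξ‖ ≤ D ξ) (x : ℝ) {y : ℝ} (hy : y ∈ s) :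
    HasDerivWithinAt (fun y => realInv (W y) x) (realInv (V y) x) s y := by
  rw [hasDerivWithinAt_iff_tendsto_slope]
  have hmem : ∀ᶠ y' in 𝓝[s \ {y}] y, y' ∈ s ∧ y' ≠ y :=
    eventually_of_mem self_mem_nhdsWithin fun y' h => ⟨h.1, h.2⟩
  have hslope : ∀ᶠ y' in 𝓝[s \ {y}] y,
      realInv (fun ξ => slope (fun y => W y ξ) y y') x = slope (fun y => realInv (W y) x) y y' := by
    filter_upwards [hmem] with y' h
    simp only [slope_def_module, real_smul]
    rw [realInv_const_mul, realInv_sub (hi _ h.1) (hi _ hy)]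
    rfl
  refine Tendsto.congr' hslope ?_
  simp only [realInv_eq]
  refine (Complex.continuous_re.tendsto _).comp
    (tendsto_integral_filter_of_dominated_convergence D ?_ ?_ hD ?_)
  · filter_upwards [hmem] with y' h
    simp only [slope_def_module]
    exact (Continuous.aestronglyMeasurable (by fun_prop)).mul
      (((hi _ h.1).sub (hi _ hy)).smul (y' - y)⁻¹).aestronglyMeasurable
  · filter_upwards [hmem] with y' h
    filter_upwards [hd, hb] with ξ h1 h2
    rw [norm_mul, Complex.norm_exp_ofReal_mul_I, one_mul, slope_def_module, norm_smul, norm_inv]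
    have := hs.norm_image_sub_le_of_norm_hasDerivWithin_le h1 h2 hy h.1
    rwa [inv_mul_le_iff₀ (norm_pos_iff.2 (sub_ne_zero.2 h.2)), mul_comm]
  · filter_upwards [hd] with ξ h1
    exact (hasDerivWithinAt_iff_tendsto_slope.1 (h1 y hy)).const_mul _

theorem intervalIntegral_realInv {W : ℝ → ℝ → ℂ} {D : ℝ → ℝ} {a b : ℝ} (hD : Integrable D)
    (hm : Measurable (Function.uncurry W)) (hb : ∀ y, ∀ ξ, ‖W y ξ‖ ≤ D ξ) (x : ℝ) :
    ∫ y in a..b, realInv (W y) x = realInv (fun ξ => ∫ y in a..b, W y ξ) x := by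
  have hfin : IsFiniteMeasure (volume.restrict (uIoc a b)) :=
    ⟨by rw [Measure.restrict_apply_univ, uIoc]; exact measure_Ioc_lt_top⟩
  have hint : Integrable (Function.uncurry fun y ξ : ℝ =>
      exp ((2 * Real.pi * (ξ * x) : ℝ) * I) * W y ξ)
      ((volume.restrict (uIoc a b)).prod volume) := by
    refine (hD.comp_snd (volume.restrict (uIoc a b))).mono'
      ((by fun_prop : Measurable fun p : ℝ × ℝ =>
        exp ((2 * Real.pi * (p.2 * x) : ℝ) * I)).mul hm).aestronglyMeasurable (ae_of_all _ fun p => ?_)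
    rw [Function.uncurry, norm_mul, Complex.norm_exp_ofReal_mul_I, one_mul]
    exact hb _ _
  have h := intervalIntegral_integral_swap hint
  simp only [realInv_eq]
  have hre : ∀ y, (∫ ξ : ℝ, exp ((2 * Real.pi * (ξ * x) : ℝ) * I) * W y ξ).re
      = Complex.reCLM (∫ ξ : ℝ, exp ((2 * Real.pi * (ξ * x) : ℝ) * I) * W y ξ) := fun _ => rfl
  simp only [hre]
  rw [ContinuousLinearMap.intervalIntegral_comp_comm, h]
  · simp only [intervalIntegral.integral_const_mul]
    rfl
  · rw [intervalIntegrable_iff]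
    exact hint.integral_prod_left

/-! ### Classical derivatives are weak derivatives -/

theorem hasDerivAt_slice_snd {φ : ℝ × ℝ → ℝ} (hφ : ContDiff ℝ ((⊤ : ℕ∞) : WithTop ℕ∞) φ) (x y : ℝ) :
    HasDerivAt (fun t => φ (x, t)) (fderiv ℝ φ (x, y) (0, 1)) y := by
  have h1 : HasDerivAt (fun t : ℝ => (x, t)) ((0 : ℝ), (1 : ℝ)) y :=
    (hasDerivAt_const y x).prodMk (hasDerivAt_id y)
  exact ((hφ.differentiable (by simp)).differentiableAt (x := (x, y))).hasFDerivAt.comp_hasDerivAt y h1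

theorem integral_mul_fderiv_snd {M : ℝ} (hM : 0 ≤ M) {f g : ℝ → ℝ → ℝ}
    (hf : Continuous (Function.uncurry f)) (hg : Continuous (Function.uncurry g))
    (hd : ∀ x, ∀ y ∈ Icc 0 M, HasDerivWithinAt (f x) (g x y) (Icc 0 M) y)
    {φ : ℝ × ℝ → ℝ} (hφ : ContDiff ℝ ((⊤ : ℕ∞) : WithTop ℕ∞) φ) (hc : HasCompactSupport φ)
    (hs : tsupport φ ⊆ strip M) :
    ∫ p : ℝ × ℝ, f p.1 p.2 * fderiv ℝ φ p (0, 1) = -∫ p : ℝ × ℝ, g p.1 p.2 * φ p := by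
  have hφ' : Continuous fun p => fderiv ℝ φ p (0, 1) :=
    (hφ.continuous_fderiv (by simp)).clm_apply continuous_const
  have hc' : HasCompactSupport fun p => fderiv ℝ φ p (0, 1) := hc.fderiv_apply (𝕜 := ℝ) (0, 1)
  have hsub : tsupport (fun p => fderiv ℝ φ p (0, 1)) ⊆ strip M :=
    (tsupport_fderiv_apply_subset ℝ _).trans hs
  have hslice : ∀ {ψ : ℝ × ℝ → ℝ}, tsupport ψ ⊆ strip M → ∀ (h : ℝ → ℝ → ℝ) (x : ℝ),
      ∫ y, h x y * ψ (x, y) = ∫ y in (0 : ℝ)..M, h x y * ψ (x, y) := by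
    intro ψ hψ h x
    refine (intervalIntegral.integral_eq_integral_of_support_subset fun y hy => ?_).symm
    have h1 := hψ (subset_tsupport _ (right_ne_zero_of_mul hy : ψ (x, y) ≠ 0))
    exact Ioo_subset_Ioc_self h1.2
  have hi1 : Integrable (fun p : ℝ × ℝ => f p.1 p.2 * fderiv ℝ φ p (0, 1)) :=
    (hf.mul hφ').integrable_of_hasCompactSupport hc'.mul_left
  have hi2 : Integrable (fun p : ℝ × ℝ => g p.1 p.2 * φ p) :=
    (hg.mul hφ.continuous).integrable_of_hasCompactSupport hc.mul_left
  rw [Measure.volume_eq_prod] at hi1 hi2 ⊢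
  rw [integral_prod _ hi1, integral_prod _ hi2, ← integral_neg]
  congr 1
  funext x
  have e1 := hslice hsub f x
  have e2 := hslice hs g x
  simp only at e1 e2 ⊢
  rw [e1, e2]
  have hz : ∀ y, y ∉ Ioo 0 M → φ (x, y) = 0 := fun y hy => by
    by_contra h
    exact hy (hs (subset_tsupport _ (show φ (x, y) ≠ 0 from h))).2
  have hfx : Continuous (f x) := hf.comp (continuous_const.prodMk continuous_id)
  have hgx : Continuous (g x) := hg.comp (continuous_const.prodMk continuous_id)
  have hφx : Continuous fun t => fderiv ℝ φ (x, t) (0, 1) :=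
    hφ'.comp (continuous_const.prodMk continuous_id)
  have hparts := intervalIntegral.integral_mul_deriv_eq_deriv_mul_of_hasDerivAt
    (u := f x) (u' := g x) (v := fun t => φ (x, t)) (v' := fun t => fderiv ℝ φ (x, t) (0, 1))
    (a := 0) (b := M) hfx.continuousOn
    (hφ.continuous.comp (continuous_const.prodMk continuous_id)).continuousOn
    (fun y hy => by
      rw [min_eq_left hM, max_eq_right hM] at hy
      exact (hd x y (Ioo_subset_Icc_self hy)).hasDerivAt (Icc_mem_nhds hy.1 hy.2))
    (fun y _ => hasDerivAt_slice_snd hφ x y)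
    (hgx.intervalIntegrable _ _) (hφx.intervalIntegrable _ _)
  rw [hparts, hz M (by simp), hz 0 (by simp)]
  ring

theorem isWeakDy_one {M : ℝ} (hM : 0 ≤ M) {f g : ℝ → ℝ → ℝ}
    (hf : Continuous (Function.uncurry f)) (hg : Continuous (Function.uncurry g))
    (hd : ∀ x, ∀ y ∈ Icc 0 M, HasDerivWithinAt (f x) (g x y) (Icc 0 M) y) : IsWeakDy M 1 f g := by
  refine ⟨hf.locallyIntegrable.locallyIntegrableOn _, hg.locallyIntegrable.locallyIntegrableOn _,
    fun φ hφ hc hs => ?_⟩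
  simp only [iteratedDeriv_one, (hasDerivAt_slice_snd hφ _ _).deriv]
  rw [integral_mul_fderiv_snd hM hf hg hd hφ hc hs]
  ring

theorem isWeakDy_two {M : ℝ} (hM : 0 ≤ M) {f g h : ℝ → ℝ → ℝ}
    (hf : Continuous (Function.uncurry f)) (hg : Continuous (Function.uncurry g))
    (hh : Continuous (Function.uncurry h))
    (hd : ∀ x, ∀ y ∈ Icc 0 M, HasDerivWithinAt (f x) (g x y) (Icc 0 M) y)
    (hd' : ∀ x, ∀ y ∈ Icc 0 M, HasDerivWithinAt (g x) (h x y) (Icc 0 M) y) :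
    IsWeakDy M 2 f h := by
  refine ⟨hf.locallyIntegrable.locallyIntegrableOn _, hh.locallyIntegrable.locallyIntegrableOn _,
    fun φ hφ hc hs => ?_⟩
  have hφ' : ContDiff ℝ ((⊤ : ℕ∞) : WithTop ℕ∞) fun p => fderiv ℝ φ p (0, 1) :=
    (hφ.fderiv_right (m := ((⊤ : ℕ∞) : WithTop ℕ∞)) (by simp)).clm_apply contDiff_const
  have hc' : HasCompactSupport fun p => fderiv ℝ φ p (0, 1) := hc.fderiv_apply (𝕜 := ℝ) (0, 1)
  have hs' : tsupport (fun p => fderiv ℝ φ p (0, 1)) ⊆ strip M :=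
    (tsupport_fderiv_apply_subset ℝ _).trans hs
  have h1 : ∀ p : ℝ × ℝ, iteratedDeriv 2 (fun t => φ (p.1, t)) p.2
      = fderiv ℝ (fun p => fderiv ℝ φ p (0, 1)) p (0, 1) := by
    intro p
    have e : deriv (fun t => φ (p.1, t)) = fun t => fderiv ℝ φ (p.1, t) (0, 1) :=
      funext fun t => (hasDerivAt_slice_snd hφ _ _).deriv
    rw [iteratedDeriv_succ, iteratedDeriv_one, e]
    exact (hasDerivAt_slice_snd hφ' _ _).deriv
  simp only [h1]
  rw [integral_mul_fderiv_snd hM hf hg hd hφ' hc' hs', integral_mul_fderiv_snd hM hg hh hd' hφ hc hs]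
  ring

/-! ### The symbol of the solution and of its `y`-derivatives -/

/-- The symbols of `ω`, `∂_y ω` and `∂_y² ω = y ∂ₓ ω` (all `j ≥ 2` give the last one) as functions
of the height `y` and the frequency `ξ`. -/
noncomputable def fieldSymbol (M : ℝ) : ℕ → ℝ → ℝ → ℂ
  | 0, y, ξ => symbolOmega M y ξ
  | 1, y, ξ => airyInt 1 1 (symbolD (1 / 3) ξ * y) / airyDerivZero
      * (I * ξ * ((|ξ| : ℝ) : ℂ) / multM M ξ)
  | _, y, ξ => y * (I * ξ * symbolOmega M y ξ)

theorem fieldSymbol_zero_freq (M : ℝ) (j : ℕ) (y : ℝ) : fieldSymbol M j y 0 = 0 := by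
  match j with
  | 0 => simp [fieldSymbol, symbolOmega]
  | 1 => simp [fieldSymbol]
  | _ + 2 => simp [fieldSymbol]

theorem symbolD_third_pow (ξ : ℝ) : symbolD (1 / 3) ξ ^ 3 = I * ξ := by
  rw [symbolD, ← Complex.cpow_nat_mul]
  have : ((3 : ℕ) : ℂ) * ((1 / 3 : ℝ) : ℂ) = 1 := by push_cast; norm_num
  rw [this, cpow_one]

theorem symbolD_two_thirds (ξ : ℝ) : symbolD (2 / 3) ξ = symbolD (1 / 3) ξ ^ 2 := by
  rw [symbolD, symbolD, ← Complex.cpow_nat_mul]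
  congr 1
  push_cast
  norm_num

theorem symbolD_third_ne_zero {ξ : ℝ} (hξ : ξ ≠ 0) : symbolD (1 / 3) ξ ≠ 0 := by
  rw [← norm_pos_iff, norm_symbolD _ hξ]
  have := abs_pos.2 hξ
  positivity

theorem rpow_third_pow_three (ξ : ℝ) : (|ξ| ^ (1 / 3 : ℝ)) ^ 3 = |ξ| := by
  rw [← Real.rpow_natCast, ← Real.rpow_mul (abs_nonneg ξ)]
  norm_num

theorem rpow_third_pow_four (ξ : ℝ) : (|ξ| ^ (1 / 3 : ℝ)) ^ 4 = |ξ| ^ (4 / 3 : ℝ) := by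
  rw [← Real.rpow_natCast, ← Real.rpow_mul (abs_nonneg ξ)]
  norm_num

/-- Size of the symbols: the Airy factor decays like `exp (-|ξ| ^ (1/3) y)`, and part of the decay
pays for the factor `y` in `∂_y² ω`. -/
theorem exists_norm_fieldSymbol_le {c : ℝ} (hc : 0 < c) :
    ∃ K : ℝ, 0 < K ∧ ∀ M : ℝ, (∀ ξ : ℝ, c * (1 + |ξ| ^ (4 / 3 : ℝ)) ≤ ‖multM M ξ‖) →
      ∀ j ≤ 2, ∀ y : ℝ, 0 ≤ y → ∀ ξ : ℝ,
        ‖fieldSymbol M j y ξ‖ ≤ K * ((|ξ| ^ (1 / 3 : ℝ)) ^ (5 + j) / (1 + (|ξ| ^ (1 / 3 : ℝ)) ^ 4))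
          * Real.exp (-(3 / 4) * (|ξ| ^ (1 / 3 : ℝ) * y)) := by
  obtain ⟨K₀, hK₀, h₀⟩ := exists_norm_airyInt_le 0 (by norm_num)
  obtain ⟨K₁, hK₁, h₁⟩ := exists_norm_airyInt_le 1 le_rfl
  have hD : 0 < ‖airyDerivZero‖ := norm_pos_iff.2 airyDerivZero_ne_zero
  refine ⟨4 * (K₀ + K₁) / (‖airyDerivZero‖ * c), by positivity, fun M hM j hj y hy ξ => ?_⟩
  rcases eq_or_ne ξ 0 with rfl | hξ
  · rw [fieldSymbol_zero_freq, norm_zero]; positivity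
  have hm := hM ξ
  rw [← rpow_third_pow_four] at hm
  have hξ3 := rpow_third_pow_three ξ
  have hcn := norm_symbolD (1 / 3) hξ
  set r := |ξ| ^ (1 / 3 : ℝ) with hr
  have hr0 : 0 < r := by have := abs_pos.2 hξ; positivity
  have hz : ‖symbolD (1 / 3) ξ * y‖ = r * y := by
    rw [norm_mul, hcn, norm_real, Real.norm_of_nonneg hy]
  have hsec := symbolD_third_mul_mem_airySector ξ hy
  have hA := h₀ _ hsec
  have hA' := h₁ _ hsec
  rw [← airyAi_eq_airyInt] at hA
  rw [hz] at hA hA'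
  have hm0 : 0 < c * (1 + r ^ 4) := by positivity
  have hq : ‖I * ξ * ((|ξ| : ℝ) : ℂ) / multM M ξ‖ ≤ r ^ 6 / (c * (1 + r ^ 4)) := by
    rw [norm_div, norm_mul, norm_mul, norm_I, one_mul, norm_real, norm_real, Real.norm_eq_abs,
      Real.norm_of_nonneg (abs_nonneg ξ), ← hξ3]
    have : r ^ 3 * r ^ 3 = r ^ 6 := by ring
    rw [this]
    gcongr
  have hexp : Real.exp (-(r * y)) ≤ Real.exp (-(3 / 4) * (r * y)) :=
    Real.exp_le_exp.2 (by nlinarith [mul_nonneg hr0.le hy])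
  have hω : ‖symbolOmega M y ξ‖
      ≤ K₀ / (‖airyDerivZero‖ * c) * (r ^ 5 / (1 + r ^ 4)) * Real.exp (-(r * y)) := by
    rw [symbolOmega, norm_neg, norm_mul, norm_div, norm_mul, hcn]
    calc _ ≤ K₀ * Real.exp (-(r * y)) / (‖airyDerivZero‖ * r) * (r ^ 6 / (c * (1 + r ^ 4))) := by
          gcongr
      _ = _ := by field_simp
  match j, hj with
  | 0, _ =>
    refine hω.trans ?_
    rw [add_zero]
    gcongr
    linarith
  | 1, _ =>
    rw [fieldSymbol, norm_mul, norm_div]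
    calc _ ≤ K₁ * Real.exp (-(r * y)) / ‖airyDerivZero‖ * (r ^ 6 / (c * (1 + r ^ 4))) := by
          gcongr
      _ = K₁ / (‖airyDerivZero‖ * c) * (r ^ (5 + 1) / (1 + r ^ 4)) * Real.exp (-(r * y)) := by
          field_simp
      _ ≤ _ := by gcongr; linarith
  | 2, _ =>
    have ht : r * y * Real.exp (-(r * y)) ≤ 4 * Real.exp (-(3 / 4) * (r * y)) := by
      have e : Real.exp (-(3 / 4) * (r * y)) = Real.exp (r * y / 4) * Real.exp (-(r * y)) := by
        rw [← Real.exp_add]; congr 1; ring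
      rw [e, ← mul_assoc]
      refine mul_le_mul_of_nonneg_right ?_ (Real.exp_nonneg _)
      linarith [Real.add_one_le_exp (r * y / 4)]
    rw [fieldSymbol, norm_mul, norm_mul, norm_mul, norm_I, one_mul, norm_real, norm_real,
      Real.norm_of_nonneg hy, Real.norm_eq_abs, ← hξ3]
    · calc _ ≤ y * (r ^ 3 * (K₀ / (‖airyDerivZero‖ * c) * (r ^ 5 / (1 + r ^ 4))
              * Real.exp (-(r * y)))) := by gcongr
        _ = K₀ / (‖airyDerivZero‖ * c) * (r ^ (5 + 2) / (1 + r ^ 4))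
              * (r * y * Real.exp (-(r * y))) := by ring
        _ ≤ K₀ / (‖airyDerivZero‖ * c) * (r ^ (5 + 2) / (1 + r ^ 4))
              * (4 * Real.exp (-(3 / 4) * (r * y))) := by gcongr
        _ = 4 * K₀ / (‖airyDerivZero‖ * c) * (r ^ (5 + 2) / (1 + r ^ 4))
              * Real.exp (-(3 / 4) * (r * y)) := by ring
        _ ≤ _ := by gcongr; linarith
    · simp
    · simp

theorem hasDerivAt_mul_ofReal (c : ℂ) (y : ℝ) : HasDerivAt (fun y : ℝ => c * y) c y := by
  simpa using (Complex.ofRealCLM.hasDerivAt (x := y)).const_mul c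

theorem hasDerivAt_fieldSymbol_zero (M y ξ : ℝ) :
    HasDerivAt (fun y => fieldSymbol M 0 y ξ) (fieldSymbol M 1 y ξ) y := by
  rcases eq_or_ne ξ 0 with rfl | hξ
  · simp only [fieldSymbol_zero_freq]; exact hasDerivAt_const y 0
  have hc := symbolD_third_ne_zero hξ
  have hD := airyDerivZero_ne_zero
  have h := ((hasDerivAt_airyAi _).comp y (hasDerivAt_mul_ofReal (symbolD (1 / 3) ξ) y))
  have h2 := ((h.div_const (airyDerivZero * symbolD (1 / 3) ξ)).mul_const
    (I * ξ * ((|ξ| : ℝ) : ℂ) / multM M ξ)).neg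
  convert! h2 using 1
  simp only [fieldSymbol]
  field_simp

theorem hasDerivAt_fieldSymbol_one (M y ξ : ℝ) :
    HasDerivAt (fun y => fieldSymbol M 1 y ξ) (fieldSymbol M 2 y ξ) y := by
  rcases eq_or_ne ξ 0 with rfl | hξ
  · simp only [fieldSymbol_zero_freq]; exact hasDerivAt_const y 0
  have hc := symbolD_third_ne_zero hξ
  have hD := airyDerivZero_ne_zero
  have h := ((hasDerivAt_airyInt_one _).comp y (hasDerivAt_mul_ofReal (symbolD (1 / 3) ξ) y))
  have h2 := (h.div_const airyDerivZero).mul_const (I * ξ * ((|ξ| : ℝ) : ℂ) / multM M ξ)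
  convert! h2 using 1
  simp only [fieldSymbol, symbolOmega]
  rw [← symbolD_third_pow]
  field_simp

theorem fieldSymbol_neg (M : ℝ) (j : ℕ) (y ξ : ℝ) :
    fieldSymbol M j y (-ξ) = starRingEnd ℂ (fieldSymbol M j y ξ) := by
  have h0 : airyAi (starRingEnd ℂ (symbolD (1 / 3) ξ) * y)
      = starRingEnd ℂ (airyAi (symbolD (1 / 3) ξ * y)) := by
    rw [← airyAi_conj, map_mul, conj_ofReal]
  have h1 : airyInt 1 1 (starRingEnd ℂ (symbolD (1 / 3) ξ) * y)
      = starRingEnd ℂ (airyInt 1 1 (symbolD (1 / 3) ξ * y)) := by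
    rw [← airyInt_conj, map_mul, conj_ofReal]
  match j with
  | 0 => simp [fieldSymbol, symbolOmega, symbolD_neg, multM_neg, h0, airyDerivZero_conj, -one_div]
  | 1 => simp [fieldSymbol, symbolD_neg, multM_neg, h1, airyDerivZero_conj, -one_div]
  | _ + 2 =>
    simp [fieldSymbol, symbolOmega, symbolD_neg, multM_neg, h0, airyDerivZero_conj, -one_div]

theorem measurable_fieldSymbol (M : ℝ) (j : ℕ) :
    Measurable (Function.uncurry (fieldSymbol M j)) := by
  have hc : Measurable fun p : ℝ × ℝ => symbolD (1 / 3) p.2 :=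
    (measurable_symbolD _).comp measurable_snd
  have hA : Measurable fun p : ℝ × ℝ => airyAi (symbolD (1 / 3) p.2 * p.1) :=
    continuous_airyAi.measurable.comp (by fun_prop)
  have hA' : Measurable fun p : ℝ × ℝ => airyInt 1 1 (symbolD (1 / 3) p.2 * p.1) :=
    (continuous_airyInt 1).measurable.comp (by fun_prop)
  have hm : Measurable fun p : ℝ × ℝ => multM M p.2 := (measurable_multM M).comp measurable_snd
  have hω : Measurable fun p : ℝ × ℝ => symbolOmega M p.1 p.2 := by
    unfold symbolOmega; fun_prop
  match j with
  | 0 => exact hω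
  | 1 =>
    have : Measurable fun p : ℝ × ℝ => airyInt 1 1 (symbolD (1 / 3) p.2 * p.1) / airyDerivZero
      * (I * p.2 * ((|p.2| : ℝ) : ℂ) / multM M p.2) := by fun_prop
    exact this
  | _ + 2 =>
    have : Measurable fun p : ℝ × ℝ => (p.1 : ℂ) * (I * p.2 * symbolOmega M p.1 p.2) := by fun_prop
    exact this

theorem continuous_fieldSymbol (M : ℝ) (j : ℕ) (ξ : ℝ) : Continuous fun y => fieldSymbol M j y ξ := by
  have h0 : Continuous fun y => symbolOmega M y ξ := continuous_iff_continuousAt.2 fun y =>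
    (hasDerivAt_fieldSymbol_zero M y ξ).continuousAt
  match j with
  | 0 => exact h0
  | 1 => exact continuous_iff_continuousAt.2 fun y =>
      (hasDerivAt_fieldSymbol_one M y ξ).continuousAt
  | _ + 2 => exact Complex.continuous_ofReal.mul (continuous_const.mul h0)

/-- The mass of `ω` across the strip; this is where `m` comes from. -/
theorem integral_symbolOmega (M ξ : ℝ) (hm : multM M ξ ≠ 0) :
    ∫ y in (0 : ℝ)..M, symbolOmega M y ξ = 1 - 1 / multM M ξ := by
  rcases eq_or_ne ξ 0 with rfl | hξ
  · have h0 : ∀ y, symbolOmega M y 0 = 0 := fun y => fieldSymbol_zero_freq M 0 y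
    have h1 : multM M 0 = 1 := by simp [multM]
    simp [h0, h1]
  have hc := symbolD_third_ne_zero hξ
  have hD := airyDerivZero_ne_zero
  have hd : ∀ y ∈ uIcc (0 : ℝ) M, HasDerivAt (fun y : ℝ => airyInt (-1) 1 (symbolD (1 / 3) ξ * y)
      / (airyDerivZero * symbolD (1 / 3) ξ ^ 2) * (I * ξ * ((|ξ| : ℝ) : ℂ) / multM M ξ))
      (symbolOmega M y ξ) y := by
    intro y _
    have h := ((hasDerivAt_airyInt_neg_one _).comp y (hasDerivAt_mul_ofReal (symbolD (1 / 3) ξ) y))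
    have h2 := (h.div_const (airyDerivZero * symbolD (1 / 3) ξ ^ 2)).mul_const
      (I * ξ * ((|ξ| : ℝ) : ℂ) / multM M ξ)
    convert! h2 using 1
    simp only [symbolOmega]
    field_simp
  rw [intervalIntegral.integral_eq_sub_of_hasDerivAt hd
    ((continuous_fieldSymbol M 0 ξ).intervalIntegrable _ _)]
  have hc2 : symbolD (1 / 3) ξ ^ 2
      = ((|ξ| ^ (1 / 3 : ℝ) : ℝ) : ℂ) ^ 2 * exp (Real.sign ξ * (Real.pi / 3) * I) := by
    rw [symbolD_eq _ hξ, mul_pow, ← Complex.exp_nat_mul]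
    congr 2
    push_cast
    ring
  have hr : ((|ξ| : ℝ) : ℂ) = ((|ξ| ^ (1 / 3 : ℝ) : ℝ) : ℂ) ^ 3 := by
    rw [← ofReal_pow, rpow_third_pow_three]
  have hr0 : ((|ξ| ^ (1 / 3 : ℝ) : ℝ) : ℂ) ≠ 0 := by
    have := abs_pos.2 hξ
    exact ofReal_ne_zero.2 (by positivity)
  have hm1 : multM M ξ - 1 = -(pM M ξ / (airyDerivZero * exp (Real.sign ξ * (Real.pi / 3) * I))
      * (I * ξ * ((|ξ| ^ (1 / 3 : ℝ) : ℝ) : ℂ))) := by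
    rw [multM]; ring
  have he := exp_ne_zero (Real.sign ξ * (Real.pi / 3) * I)
  have hgoal : (1 : ℂ) - 1 / multM M ξ = (multM M ξ - 1) / multM M ξ := by field_simp
  rw [hgoal, hm1, pM_eq, hc2, hr, ofReal_zero, mul_zero]
  generalize airyInt (-1) 1 (symbolD (1 / 3) ξ * M) = B
  generalize airyInt (-1) 1 0 = J
  field_simp
  ring

/-- The trace condition in terms of symbols. -/
theorem symbolOmega_eq (M y ξ : ℝ) :
    symbolOmega M y ξ = airyAi (y * symbolD (1 / 3) ξ) / airyDerivZero * symbolD (2 / 3) ξ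
      * ((|ξ| : ℝ) : ℂ) * (-1 / multM M ξ) := by
  rcases eq_or_ne ξ 0 with rfl | hξ
  · simp [symbolOmega]
  have hc := symbolD_third_ne_zero hξ
  have hD := airyDerivZero_ne_zero
  rw [symbolOmega, ← symbolD_third_pow, symbolD_two_thirds, mul_comm (y : ℂ)]
  field_simp

theorem fieldSymbol_one_zero (M ξ : ℝ) :
    fieldSymbol M 1 0 ξ = I * ξ * ((|ξ| : ℝ) : ℂ) * (-1 / multM M ξ) := by
  have hD := airyDerivZero_ne_zero
  have h : airyInt 1 1 0 = -airyDerivZero := by rw [airyDerivZero_eq, neg_neg]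
  rw [fieldSymbol, ofReal_zero, mul_zero, h, neg_div, div_self hD]
  ring

/-! ### Weighted estimates on the strip -/

/-- The density `(1 + ξ²) |F̂|`, whose `L²` norm is the `H²` norm of `F`. -/
noncomputable def h2Density (F : ℝ → ℝ) (ξ : ℝ) : ℝ :=
  (1 + (2 * Real.pi * ξ) ^ 2) * ‖fourierL2 F ξ‖

theorem measurable_h2Density (F : ℝ → ℝ) : Measurable (h2Density F) := by
  have := measurable_fourierL2 F
  unfold h2Density
  fun_prop

theorem eLpNorm_two_sq {α E : Type*} [MeasurableSpace α] [NormedAddCommGroup E] (μ : Measure α)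
    (g : α → E) : eLpNorm g 2 μ ^ 2 = ∫⁻ x, ‖g x‖ₑ ^ 2 ∂μ := by
  have := eLpNorm_nnreal_pow_eq_lintegral (μ := μ) (f := g) (p := 2) two_ne_zero
  simpa using! this

theorem rpow_half_le_of_le_sq {a b : ℝ≥0∞} (h : a ≤ b ^ 2) : a ^ (1 / 2 : ℝ) ≤ b := by
  rw [one_div, ENNReal.rpow_inv_le_iff two_pos]
  exact_mod_cast h

theorem memLp_of_eNormH_lt_top {s : ℝ} {F : ℝ → ℝ} (h : eNormH s F < ∞) : MemLp F 2 := by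
  by_contra hF
  simp [eNormH, hF] at h

theorem eLpNorm_h2Density {F : ℝ → ℝ} (hF : MemLp F 2) :
    eLpNorm (h2Density F) 2 volume = eNormH 2 F := by
  have h1 : ∀ ξ, ENNReal.ofReal ((1 + (2 * Real.pi * ξ) ^ 2) ^ (2 : ℝ)) * ‖fourierL2 F ξ‖ₑ ^ 2
      = ‖h2Density F ξ‖ₑ ^ 2 := by
    intro ξ
    rw [h2Density, enorm_mul, enorm_norm, mul_pow _ ‖fourierL2 F ξ‖ₑ,
      Real.enorm_of_nonneg (by positivity), Real.rpow_two, ENNReal.ofReal_pow (by positivity)]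
  rw [eNormH, iInf_pos hF]
  simp only [h1]
  rw [← eLpNorm_two_sq, ← ENNReal.rpow_natCast, ← ENNReal.rpow_mul]
  norm_num

/-- `f` is continuous, and its transform in `x` obeys the bound satisfied by the `j`-th
`y`-derivative of the solution with datum `F`. -/
structure HasSymbolBound (M K : ℝ) (j : ℕ) (F : ℝ → ℝ) (f : ℝ → ℝ → ℝ) : Prop where
  continuous : Continuous (Function.uncurry f)
  memLp : ∀ y ∈ Ioo 0 M, MemLp (fun x => f x y) 2
  bound : ∀ y ∈ Ioo 0 M, ∀ᵐ ξ : ℝ, ‖fourierL2 (fun x => f x y) ξ‖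
    ≤ K * ((|2 * Real.pi * ξ| ^ (1 / 3 : ℝ)) ^ (5 + j) / (1 + (|2 * Real.pi * ξ| ^ (1 / 3 : ℝ)) ^ 4))
      * Real.exp (-(3 / 4) * (|2 * Real.pi * ξ| ^ (1 / 3 : ℝ) * y)) * ‖fourierL2 F ξ‖

theorem lintegral_exp_decay_le_one (M : ℝ) {r : ℝ} (hr : 0 ≤ r) :
    ∫⁻ y in Ioo 0 M, ENNReal.ofReal (r * Real.exp (-(r * y))) ≤ 1 := by
  rcases le_total M 0 with hM | hM
  · simp [Ioo_eq_empty_of_le hM]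
  have hc : Continuous fun y => r * Real.exp (-(r * y)) := by fun_prop
  rw [restrict_Ioo_eq_restrict_Ioc, ← ofReal_integral_eq_lintegral_ofReal
    ((hc.intervalIntegrable 0 M).1) (ae_of_all _ fun y => by positivity),
    ← intervalIntegral.integral_of_le hM,
    intervalIntegral.integral_eq_sub_of_hasDerivAt (f := fun y => -Real.exp (-(r * y)))
      (fun y _ => ?_) (hc.intervalIntegrable _ _)]
  · rw [← ENNReal.ofReal_one]
    refine ENNReal.ofReal_le_ofReal ?_
    simp [Real.exp_nonneg]
  · have h1 : HasDerivAt (fun y : ℝ => -(r * y)) (-r) y := by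
      simpa using! ((hasDerivAt_id y).const_mul r).neg
    convert! h1.exp.neg using 1
    ring

/-- The scaling `|ξ| ^ (1/3) y` turns the weight `|ξ| ^ s y ^ k` into a power of `r = |ξ| ^ (1/3)`;
the stated range of exponents is the one that two derivatives of the datum control. -/
theorem weight_mul_le {r y s k : ℝ} {j : ℕ} (hr : 0 < r) (hy : 0 < y) (hk0 : 0 ≤ k) (hk1 : k ≤ 1)
    (hp0 : 0 ≤ 3 * s - k + j + 9 / 2) (hp1 : 3 * s - k + j + 9 / 2 ≤ 10) :
    (r ^ 3) ^ s * y ^ k * (r ^ (5 + j) / (1 + r ^ 4) * Real.exp (-(3 / 4) * (r * y)))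
      ≤ 4 * (r ^ (1 / 2 : ℝ) * Real.exp (-(r * y) / 2) * (1 + r ^ 6)) := by
  set p := 3 * s - k + j + 9 / 2 with hp
  have hry : 0 < r * y := mul_pos hr hy
  have e1 : (r ^ 3) ^ s * y ^ k * r ^ (5 + j) = r ^ (1 / 2 : ℝ) * r ^ p * (r * y) ^ k := by
    rw [Real.mul_rpow hr.le hy.le, ← Real.rpow_natCast r 3, ← Real.rpow_natCast r (5 + j),
      ← Real.rpow_mul hr.le, mul_right_comm, ← Real.rpow_add hr, ← Real.rpow_add hr, ← mul_assoc,
      ← Real.rpow_add hr]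
    congr 2
    rw [hp]; push_cast; ring
  have e2 : r ^ p ≤ (1 + r ^ 4) * (1 + r ^ 6) := by
    have : r ^ p ≤ 1 + r ^ 10 := by
      rcases le_total r 1 with h | h
      · have := Real.rpow_le_one hr.le h hp0
        have : 0 < r ^ 10 := by positivity
        linarith
      · have := Real.rpow_le_rpow_of_exponent_le h hp1
        have e : r ^ (10 : ℝ) = r ^ (10 : ℕ) := by rw [← Real.rpow_natCast]; norm_num
        rw [e] at this
        linarith
    nlinarith [pow_pos hr 4, pow_pos hr 6]
  have e3 : (r * y) ^ k ≤ 4 * Real.exp (r * y / 4) := by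
    have : (r * y) ^ k ≤ 1 + r * y := by
      rcases le_total (r * y) 1 with h | h
      · have := Real.rpow_le_one hry.le h hk0
        linarith
      · have := Real.rpow_le_rpow_of_exponent_le h hk1
        rw [Real.rpow_one] at this
        linarith
    linarith [Real.add_one_le_exp (r * y / 4)]
  have e4 : Real.exp (-(r * y) / 2) = Real.exp (r * y / 4) * Real.exp (-(3 / 4) * (r * y)) := by
    rw [← Real.exp_add]; congr 1; ring
  calc _ = (r ^ 3) ^ s * y ^ k * r ^ (5 + j) / (1 + r ^ 4) * Real.exp (-(3 / 4) * (r * y)) := by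
        ring
    _ = r ^ (1 / 2 : ℝ) * r ^ p * (r * y) ^ k / (1 + r ^ 4) * Real.exp (-(3 / 4) * (r * y)) := by
        rw [e1]
    _ ≤ r ^ (1 / 2 : ℝ) * ((1 + r ^ 4) * (1 + r ^ 6)) * (4 * Real.exp (r * y / 4)) / (1 + r ^ 4)
          * Real.exp (-(3 / 4) * (r * y)) := by gcongr
    _ = _ := by rw [e4]; field_simp

theorem HasSymbolBound.lintegral_le {M K : ℝ} {j : ℕ} {F : ℝ → ℝ} {f : ℝ → ℝ → ℝ}
    (h : HasSymbolBound M K j F f) (hK : 0 ≤ K) {s k : ℝ} (hk0 : 0 ≤ k) (hk1 : k ≤ 1)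
    (hp0 : 0 ≤ 3 * s - k + j + 9 / 2) (hp1 : 3 * s - k + j + 9 / 2 ≤ 10) :
    ∫⁻ y in Ioo 0 M, ∫⁻ ξ : ℝ, ENNReal.ofReal (((2 * Real.pi * |ξ|) ^ s * y ^ k) ^ 2)
        * ‖fourierL2 (fun x => f x y) ξ‖ₑ ^ 2
      ≤ (ENNReal.ofReal (4 * K) * eLpNorm (h2Density F) 2 volume) ^ 2 := by
  let r : ℝ → ℝ := fun ξ => |2 * Real.pi * ξ| ^ (1 / 3 : ℝ)
  have hr0 : ∀ ξ, 0 ≤ r ξ := fun ξ => by positivity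
  have hrm : Measurable r := by fun_prop
  have hpt : ∀ y ∈ Ioo 0 M, ∀ᵐ ξ : ℝ, ENNReal.ofReal (((2 * Real.pi * |ξ|) ^ s * y ^ k) ^ 2)
        * ‖fourierL2 (fun x => f x y) ξ‖ₑ ^ 2
      ≤ ENNReal.ofReal (r ξ * Real.exp (-(r ξ * y)))
        * (ENNReal.ofReal (4 * K) ^ 2 * ‖h2Density F ξ‖ₑ ^ 2) := by
    intro y hy
    have hne : ∀ᵐ ξ : ℝ, ξ ≠ 0 := by simp [ae_iff]
    filter_upwards [h.bound y hy, hne] with ξ hb hξ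
    have habs : 0 < |2 * Real.pi * ξ| :=
      abs_pos.2 (mul_ne_zero (mul_ne_zero two_ne_zero Real.pi_ne_zero) hξ)
    have hr : 0 < r ξ := by positivity
    have hr3 : r ξ ^ 3 = |2 * Real.pi * ξ| := rpow_third_pow_three _
    have hw := weight_mul_le (r := r ξ) (y := y) hr hy.1 hk0 hk1 hp0 hp1
    have habs2 : 2 * Real.pi * |ξ| = r ξ ^ 3 := by
      rw [hr3, abs_mul, abs_of_pos (by positivity : 0 < 2 * Real.pi)]
    have hr6 : (2 * Real.pi * ξ) ^ 2 = r ξ ^ 6 := by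
      rw [← sq_abs, ← hr3]; ring
    have hy0 := hy.1
    have hmain : (2 * Real.pi * |ξ|) ^ s * y ^ k * ‖fourierL2 (fun x => f x y) ξ‖
        ≤ r ξ ^ (1 / 2 : ℝ) * Real.exp (-(r ξ * y) / 2) * (4 * K * h2Density F ξ) := by
      rw [habs2]
      calc (r ξ ^ 3) ^ s * y ^ k * ‖fourierL2 (fun x => f x y) ξ‖
          ≤ (r ξ ^ 3) ^ s * y ^ k * (K * (r ξ ^ (5 + j) / (1 + r ξ ^ 4))
            * Real.exp (-(3 / 4) * (r ξ * y)) * ‖fourierL2 F ξ‖) := by gcongr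
        _ = (r ξ ^ 3) ^ s * y ^ k * (r ξ ^ (5 + j) / (1 + r ξ ^ 4)
            * Real.exp (-(3 / 4) * (r ξ * y))) * (K * ‖fourierL2 F ξ‖) := by ring
        _ ≤ 4 * (r ξ ^ (1 / 2 : ℝ) * Real.exp (-(r ξ * y) / 2) * (1 + r ξ ^ 6))
            * (K * ‖fourierL2 F ξ‖) := by gcongr
        _ = _ := by rw [h2Density, hr6]; ring
    have hg : 0 ≤ h2Density F ξ := by unfold h2Density; positivity
    have hsq : (r ξ ^ (1 / 2 : ℝ) * Real.exp (-(r ξ * y) / 2)) ^ 2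
        = r ξ * Real.exp (-(r ξ * y)) := by
      rw [mul_pow, ← Real.rpow_natCast, ← Real.rpow_mul hr.le, ← Real.exp_nat_mul]
      congr 1
      · norm_num
      · congr 1; push_cast; ring
    have hl : ENNReal.ofReal (((2 * Real.pi * |ξ|) ^ s * y ^ k) ^ 2)
        * ‖fourierL2 (fun x => f x y) ξ‖ₑ ^ 2
        = ENNReal.ofReal (((2 * Real.pi * |ξ|) ^ s * y ^ k * ‖fourierL2 (fun x => f x y) ξ‖) ^ 2) := by
      rw [mul_pow (_ * _), ENNReal.ofReal_mul (by positivity), ENNReal.ofReal_pow (norm_nonneg _),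
        ofReal_norm]
    have hrhs : ENNReal.ofReal (r ξ * Real.exp (-(r ξ * y)))
        * (ENNReal.ofReal (4 * K) ^ 2 * ‖h2Density F ξ‖ₑ ^ 2)
        = ENNReal.ofReal ((r ξ ^ (1 / 2 : ℝ) * Real.exp (-(r ξ * y) / 2)
          * (4 * K * h2Density F ξ)) ^ 2) := by
      rw [mul_pow (_ * _), hsq, mul_pow (4 * K),
        ENNReal.ofReal_mul (p := r ξ * Real.exp (-(r ξ * y))) (by positivity),
        ENNReal.ofReal_mul (p := (4 * K) ^ 2) (by positivity), Real.enorm_of_nonneg hg,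
        ENNReal.ofReal_pow (by positivity), ENNReal.ofReal_pow hg]
    rw [hl, hrhs]
    refine ENNReal.ofReal_le_ofReal (pow_le_pow_left₀ (by positivity) hmain 2)
  have hgm := measurable_h2Density F
  calc _ ≤ ∫⁻ y in Ioo 0 M, ∫⁻ ξ : ℝ, ENNReal.ofReal (r ξ * Real.exp (-(r ξ * y)))
        * (ENNReal.ofReal (4 * K) ^ 2 * ‖h2Density F ξ‖ₑ ^ 2) :=
        setLIntegral_mono' measurableSet_Ioo fun y hy => lintegral_mono_ae (hpt y hy)
    _ = ∫⁻ ξ : ℝ, ∫⁻ y in Ioo 0 M, ENNReal.ofReal (r ξ * Real.exp (-(r ξ * y)))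
        * (ENNReal.ofReal (4 * K) ^ 2 * ‖h2Density F ξ‖ₑ ^ 2) := by
        refine lintegral_lintegral_swap (Measurable.aemeasurable ?_)
        unfold Function.uncurry
        fun_prop
    _ ≤ ∫⁻ ξ : ℝ, ENNReal.ofReal (4 * K) ^ 2 * ‖h2Density F ξ‖ₑ ^ 2 := by
        refine lintegral_mono fun ξ => ?_
        rw [lintegral_mul_const _ (by fun_prop)]
        exact mul_le_of_le_one_left' (lintegral_exp_decay_le_one M (hr0 ξ))
    _ = _ := by
        rw [lintegral_const_mul _ (by fun_prop), ← eLpNorm_two_sq, mul_pow]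

theorem restrict_strip_eq (M : ℝ) : (volume : Measure (ℝ × ℝ)).restrict (strip M)
    = (volume : Measure ℝ).prod (volume.restrict (Ioo 0 M)) := by
  rw [strip, Measure.volume_eq_prod, ← Measure.prod_restrict, Measure.restrict_univ]

theorem HasSymbolBound.eLpNorm_le {M K : ℝ} {j : ℕ} {F : ℝ → ℝ} {f : ℝ → ℝ → ℝ}
    (h : HasSymbolBound M K j F f) (hK : 0 ≤ K) (hj : j ≤ 2) :
    eLpNorm (Function.uncurry f) 2 (volume.restrict (strip M))
      ≤ ENNReal.ofReal (4 * K) * eLpNorm (h2Density F) 2 volume := by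
  have hj' : (j : ℝ) ≤ 2 := by exact_mod_cast hj
  have hj0 : (0 : ℝ) ≤ j := Nat.cast_nonneg j
  have h1 := h.lintegral_le hK (s := 0) (k := 0) le_rfl zero_le_one (by linarith) (by linarith)
  simp only [Real.rpow_zero, mul_one, one_pow, ENNReal.ofReal_one, one_mul] at h1
  have h2 : eLpNorm (Function.uncurry f) 2 (volume.restrict (strip M)) ^ 2
      = ∫⁻ y in Ioo 0 M, ∫⁻ ξ : ℝ, ‖fourierL2 (fun x => f x y) ξ‖ₑ ^ 2 := by
    rw [eLpNorm_two_sq, restrict_strip_eq, lintegral_prod_symm]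
    · refine setLIntegral_congr_fun measurableSet_Ioo fun y hy => ?_
      rw [lintegral_enorm_fourierL2 (h.memLp y hy)]
      rfl
    · exact (h.continuous.measurable.enorm.pow_const 2).aemeasurable
  rw [← h2] at h1
  exact (ENNReal.pow_le_pow_left_iff two_ne_zero).1 h1

theorem HasSymbolBound.eNormMult_le {M K : ℝ} {j : ℕ} {F : ℝ → ℝ} {f : ℝ → ℝ → ℝ}
    (h : HasSymbolBound M K j F f) (hK : 0 ≤ K) (hj : j ≤ 2)
    (hF : eLpNorm (h2Density F) 2 volume < ∞) {s k : ℝ} (hk0 : 0 ≤ k) (hk1 : k ≤ 1)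
    (hp0 : 0 ≤ 3 * s - k + j + 9 / 2) (hp1 : 3 * s - k + j + 9 / 2 ≤ 10) :
    eNormMult M s k f ≤ ENNReal.ofReal (4 * K) * eLpNorm (h2Density F) 2 volume := by
  have hmem : MemLp (Function.uncurry f) 2 (volume.restrict (strip M)) :=
    ⟨h.continuous.aestronglyMeasurable,
      (h.eLpNorm_le hK hj).trans_lt (ENNReal.mul_lt_top ENNReal.ofReal_lt_top hF)⟩
  rw [eNormMult, iInf_pos hmem]
  exact rpow_half_le_of_le_sq (h.lintegral_le hK hk0 hk1 hp0 hp1)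

/-- The norm of `X_a` is controlled by the datum in `H²`, for `a ≤ 7/3`. -/
theorem eNormX_le {M K a : ℝ} {F : ℝ → ℝ} {ω ωy ωyy : ℝ → ℝ → ℝ}
    (hK : 0 ≤ K) (ha0 : 0 ≤ a) (ha : a ≤ 7 / 3) (hF : eLpNorm (h2Density F) 2 volume < ∞)
    (h0 : HasSymbolBound M K 0 F ω) (h1 : HasSymbolBound M K 1 F ωy)
    (h2 : HasSymbolBound M K 2 F ωyy) (hw1 : IsWeakDy M 1 ω ωy) (hw2 : IsWeakDy M 2 ω ωyy) :
    eNormX M a ω ≤ 7 * (ENNReal.ofReal (4 * K) * eLpNorm (h2Density F) 2 volume) := by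
  have e1 := h0.eLpNorm_le hK (by norm_num)
  have e2 := h0.eNormMult_le hK (by norm_num) hF (s := 1 / 18) (k := 1 / 6) (by norm_num)
    (by norm_num) (by norm_num) (by norm_num)
  have e3 := h0.eNormMult_le hK (by norm_num) hF (s := 1 + a / 2) (k := 1) (by norm_num)
    (by norm_num) (by push_cast; linarith) (by push_cast; linarith)
  have e4 := h0.eNormMult_le hK (by norm_num) hF (s := 2 / 3 + a / 2) (k := 0) (by norm_num)
    (by norm_num) (by push_cast; linarith) (by push_cast; linarith)
  have e5 : eNormMultDy M 1 (1 / 3 + a / 2) 0 ω ≤ _ := (iInf₂_le ωy hw1).trans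
    (h1.eNormMult_le hK (by norm_num) hF (s := 1 / 3 + a / 2) (k := 0) (by norm_num)
    (by norm_num) (by push_cast; linarith) (by push_cast; linarith))
  have e6 : eNormMultDy M 2 (a / 2) 0 ω ≤ _ := (iInf₂_le ωyy hw2).trans
    (h2.eNormMult_le hK (by norm_num) hF (s := a / 2) (k := 0) (by norm_num)
    (by norm_num) (by push_cast; linarith) (by push_cast; linarith))
  have e7 : eNormMultDy M 1 ((1 + a) / 2) (1 / 2) ω ≤ _ := (iInf₂_le ωy hw1).trans
    (h1.eNormMult_le hK (by norm_num) hF (s := (1 + a) / 2) (k := 1 / 2) (by norm_num)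
    (by norm_num) (by push_cast; linarith) (by push_cast; linarith))
  rw [eNormX, eNormY]
  set B := ENNReal.ofReal (4 * K) * eLpNorm (h2Density F) 2 volume
  calc _ ≤ B + B + (B + B + B + B + B) := by gcongr
    _ = 7 * B := by ring

/-! ### Integrability of the transform of the datum -/

/-- `(1 + ξ²) ^ (-1/3)`, a square-integrable function. -/
noncomputable def decayThird (ξ : ℝ) : ℝ := (1 + (2 * Real.pi * ξ) ^ 2) ^ (-(1 / 3) : ℝ)

theorem memLp_decayThird : MemLp decayThird 2 := by
  have hc : Continuous decayThird := by
    unfold decayThird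
    exact Continuous.rpow_const (by fun_prop) fun ξ => Or.inl (by positivity)
  rw [memLp_two_iff_integrable_sq hc.aestronglyMeasurable]
  have h := integrable_rpow_neg_one_add_norm_sq (E := ℝ) (μ := volume) (r := 4 / 3)
    (by norm_num)
  refine h.mono' (hc.pow 2).aestronglyMeasurable (ae_of_all _ fun ξ => ?_)
  have e : decayThird ξ ^ 2 = (1 + (2 * Real.pi * ξ) ^ 2) ^ (-(4 / 3) / 2 : ℝ) := by
    rw [decayThird, ← Real.rpow_natCast, ← Real.rpow_mul (by positivity)]
    norm_num
  rw [Real.norm_of_nonneg (by positivity), e, Real.norm_eq_abs, sq_abs]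
  refine Real.rpow_le_rpow_of_nonpos (by positivity) ?_ (by norm_num)
  have : 1 ≤ 2 * Real.pi := by linarith [Real.pi_gt_three]
  have h2 : 1 ≤ (2 * Real.pi) ^ 2 := one_le_pow₀ this
  rw [mul_pow]
  nlinarith [sq_nonneg ξ]

/-- The `L¹` majorant `(1 + ξ²) ^ (-1/3) (1 + ξ²) |F̂|` still leaves room for the factor
`1 + |ξ| ^ (4/3)`, the largest one met in the fields and their classical derivatives. -/
theorem norm_fourierL2_le (F : ℝ → ℝ) (ξ : ℝ) :
    (1 + (|2 * Real.pi * ξ| ^ (1 / 3 : ℝ)) ^ 4) * ‖fourierL2 F ξ‖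
      ≤ 2 * (decayThird ξ * h2Density F ξ) := by
  have h3 := rpow_third_pow_three (2 * Real.pi * ξ)
  set r := |2 * Real.pi * ξ| ^ (1 / 3 : ℝ)
  have hr : 0 ≤ r := by positivity
  have hr6 : (2 * Real.pi * ξ) ^ 2 = r ^ 6 := by rw [← sq_abs, ← h3]; ring
  have e : decayThird ξ * h2Density F ξ = (1 + r ^ 6) ^ (2 / 3 : ℝ) * ‖fourierL2 F ξ‖ := by
    rw [decayThird, h2Density, hr6, ← mul_assoc, ← Real.rpow_add_one (by positivity)]
    norm_num
  have h4 : 1 + r ^ 4 ≤ 2 * (1 + r ^ 6) ^ (2 / 3 : ℝ) := by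
    have a1 : (1 : ℝ) ≤ (1 + r ^ 6) ^ (2 / 3 : ℝ) :=
      Real.one_le_rpow (by nlinarith [pow_nonneg hr 6]) (by norm_num)
    have a2 : r ^ 4 ≤ (1 + r ^ 6) ^ (2 / 3 : ℝ) := by
      calc r ^ 4 = (r ^ 6) ^ (2 / 3 : ℝ) := by
            rw [← Real.rpow_natCast r 6, ← Real.rpow_mul hr]; norm_num
        _ ≤ _ := by gcongr; linarith
    linarith
  rw [e]
  nlinarith [norm_nonneg (fourierL2 F ξ)]

theorem memLp_h2Density {F : ℝ → ℝ} (hF : eLpNorm (h2Density F) 2 volume < ∞) :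
    MemLp (h2Density F) 2 := ⟨(measurable_h2Density F).aestronglyMeasurable, hF⟩

theorem integrable_decay_mul {F : ℝ → ℝ} (hF : eLpNorm (h2Density F) 2 volume < ∞) :
    Integrable fun ξ => decayThird ξ * h2Density F ξ :=
  memLp_decayThird.integrable_mul (memLp_h2Density hF)

theorem lintegral_decay_mul_le (F : ℝ → ℝ) :
    ∫⁻ ξ, ‖decayThird ξ * h2Density F ξ‖ₑ
      ≤ eLpNorm decayThird 2 volume * eLpNorm (h2Density F) 2 volume := by
  have := eLpNorm_smul_le_mul_eLpNorm (p := 2) (q := 2) (r := 1)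
    (measurable_h2Density F).aestronglyMeasurable (μ := volume)
    memLp_decayThird.aestronglyMeasurable
  rw [eLpNorm_one_eq_lintegral_enorm] at this
  exact this

/-! ### The solution fields -/

theorem decayThird_nonneg (ξ : ℝ) : 0 ≤ decayThird ξ := by unfold decayThird; positivity

theorem decayThird_le_one (ξ : ℝ) : decayThird ξ ≤ 1 :=
  Real.rpow_le_one_of_one_le_of_nonpos (by nlinarith [sq_nonneg (2 * Real.pi * ξ)]) (by norm_num)

theorem h2Density_nonneg (F : ℝ → ℝ) (ξ : ℝ) : 0 ≤ h2Density F ξ := by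
  unfold h2Density; positivity

theorem integrable_fourierL2 {F : ℝ → ℝ} (hF : eLpNorm (h2Density F) 2 volume < ∞) :
    Integrable (fourierL2 F) := by
  refine ((integrable_decay_mul hF).const_mul 2).mono' (measurable_fourierL2 F).aestronglyMeasurable
    (ae_of_all _ fun ξ => ?_)
  refine le_trans ?_ (norm_fourierL2_le F ξ)
  have : 0 ≤ (|2 * Real.pi * ξ| ^ (1 / 3 : ℝ)) ^ 4 := by positivity
  nlinarith [norm_nonneg (fourierL2 F ξ)]

theorem memLp_decay_mul {F : ℝ → ℝ} (hF : eLpNorm (h2Density F) 2 volume < ∞) :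
    MemLp (fun ξ => decayThird ξ * h2Density F ξ) 2 := by
  refine (memLp_h2Density hF).mono' (integrable_decay_mul hF).aestronglyMeasurable
    (ae_of_all _ fun ξ => ?_)
  rw [Real.norm_of_nonneg (mul_nonneg (decayThird_nonneg ξ) (h2Density_nonneg F ξ))]
  exact mul_le_of_le_one_left (h2Density_nonneg F ξ) (decayThird_le_one ξ)

/-- The Fourier transform in `x` of `ω`, `∂_y ω`, `∂_y² ω` for `j = 0, 1, 2`. The height is
clamped to `[0, M]`: the symbols grow for `y < 0`, and the clamped fields are continuous on the
whole plane. -/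
noncomputable def fieldTransform (M : ℝ) (F : ℝ → ℝ) (j : ℕ) (y ξ : ℝ) : ℂ :=
  fieldSymbol M j (max 0 (min M y)) (2 * Real.pi * ξ) * fourierL2 F ξ

/-- The fields `ω`, `∂_y ω`, `∂_y² ω` for `j = 0, 1, 2`. -/
noncomputable def field (M : ℝ) (F : ℝ → ℝ) (j : ℕ) (x y : ℝ) : ℝ :=
  realInv (fieldTransform M F j y) x

/-- The Fourier transform of the displacement `A`. -/
noncomputable def displacementTransform (M : ℝ) (F : ℝ → ℝ) (ξ : ℝ) : ℂ :=
  -fourierL2 F ξ / multM M (2 * Real.pi * ξ)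

/-- The bound on the symbols given by `exists_norm_fieldSymbol_le`. -/
def SymbolBound (M K : ℝ) : Prop :=
  ∀ j ≤ 2, ∀ y : ℝ, 0 ≤ y → ∀ ξ : ℝ,
    ‖fieldSymbol M j y ξ‖ ≤ K * ((|ξ| ^ (1 / 3 : ℝ)) ^ (5 + j) / (1 + (|ξ| ^ (1 / 3 : ℝ)) ^ 4))
      * Real.exp (-(3 / 4) * (|ξ| ^ (1 / 3 : ℝ) * y))

theorem clamp_eq {M y : ℝ} (hy : y ∈ Icc 0 M) : max 0 (min M y) = y := by
  rw [min_eq_right hy.2, max_eq_right hy.1]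

theorem fieldTransform_of_mem {M y : ℝ} (hy : y ∈ Icc 0 M) (F : ℝ → ℝ) (j : ℕ) (ξ : ℝ) :
    fieldTransform M F j y ξ = fieldSymbol M j y (2 * Real.pi * ξ) * fourierL2 F ξ := by
  rw [fieldTransform, clamp_eq hy]

theorem measurable_uncurry_fieldTransform (M : ℝ) (F : ℝ → ℝ) (j : ℕ) :
    Measurable (Function.uncurry (fieldTransform M F j)) := by
  have h1 := measurable_fieldSymbol M j
  have h2 := measurable_fourierL2 F
  have h3 : Measurable fun p : ℝ × ℝ => (max 0 (min M p.1), 2 * Real.pi * p.2) := by fun_prop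
  exact (h1.comp h3).mul (h2.comp measurable_snd)

theorem measurable_fieldTransform (M : ℝ) (F : ℝ → ℝ) (j : ℕ) (y : ℝ) :
    Measurable (fieldTransform M F j y) :=
  (measurable_uncurry_fieldTransform M F j).comp (measurable_const.prodMk measurable_id)

theorem pow_div_le_one_add {r : ℝ} (hr : 0 ≤ r) {n : ℕ} (hn : n ≤ 8) :
    r ^ n / (1 + r ^ 4) ≤ 1 + r ^ 4 := by
  rw [div_le_iff₀ (by positivity)]
  have h4 : 0 ≤ r ^ 4 := by positivity
  rcases le_total r 1 with h | h
  · have := pow_le_one₀ hr h (n := n)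
    nlinarith
  · have := pow_le_pow_right₀ h hn
    nlinarith

theorem exp_neg_mul_le_one {r y : ℝ} (hr : 0 ≤ r) (hy : 0 ≤ y) :
    Real.exp (-(3 / 4) * (r * y)) ≤ 1 :=
  Real.exp_le_one_iff.2 (by nlinarith [mul_nonneg hr hy])

theorem norm_fieldTransform_le {M K : ℝ} (hK : 0 ≤ K) (hb : SymbolBound M K) (F : ℝ → ℝ) {j : ℕ}
    (hj : j ≤ 2) (y ξ : ℝ) :
    ‖fieldTransform M F j y ξ‖ ≤ 2 * K * (decayThird ξ * h2Density F ξ) := by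
  have hy : 0 ≤ max 0 (min M y) := le_max_left _ _
  have h1 := hb j hj _ hy (2 * Real.pi * ξ)
  have h2 := norm_fourierL2_le F ξ
  rw [fieldTransform, norm_mul]
  set r := |2 * Real.pi * ξ| ^ (1 / 3 : ℝ)
  have hr : 0 ≤ r := by positivity
  have h3 := pow_div_le_one_add hr (n := 5 + j) (by omega)
  have h4 := exp_neg_mul_le_one hr hy
  calc _ ≤ K * (r ^ (5 + j) / (1 + r ^ 4)) * Real.exp (-(3 / 4) * (r * max 0 (min M y)))
        * ‖fourierL2 F ξ‖ := by gcongr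
    _ ≤ K * (1 + r ^ 4) * 1 * ‖fourierL2 F ξ‖ := by gcongr
    _ = K * ((1 + r ^ 4) * ‖fourierL2 F ξ‖) := by ring
    _ ≤ K * (2 * (decayThird ξ * h2Density F ξ)) := by gcongr
    _ = _ := by ring

theorem norm_deriv_fieldTransform_le {M K : ℝ} (hK : 0 ≤ K) (hb : SymbolBound M K) (F : ℝ → ℝ)
    (y ξ : ℝ) : ‖I * (2 * Real.pi * ξ : ℝ) * fieldTransform M F 0 y ξ‖
      ≤ 2 * K * (decayThird ξ * h2Density F ξ) := by
  have hy : 0 ≤ max 0 (min M y) := le_max_left _ _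
  have h1 := hb 0 (by norm_num) _ hy (2 * Real.pi * ξ)
  have h2 := norm_fourierL2_le F ξ
  have hξ := rpow_third_pow_three (2 * Real.pi * ξ)
  rw [fieldTransform, norm_mul, norm_mul, norm_mul, norm_I, one_mul, norm_real, Real.norm_eq_abs,
    ← hξ]
  set r := |2 * Real.pi * ξ| ^ (1 / 3 : ℝ)
  have hr : 0 ≤ r := by positivity
  have h3 := pow_div_le_one_add hr (n := 8) le_rfl
  have h4 := exp_neg_mul_le_one hr hy
  calc _ ≤ r ^ 3 * (K * (r ^ (5 + 0) / (1 + r ^ 4))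
        * Real.exp (-(3 / 4) * (r * max 0 (min M y))) * ‖fourierL2 F ξ‖) := by gcongr
    _ = K * (r ^ 8 / (1 + r ^ 4)) * Real.exp (-(3 / 4) * (r * max 0 (min M y)))
        * ‖fourierL2 F ξ‖ := by ring
    _ ≤ K * (1 + r ^ 4) * 1 * ‖fourierL2 F ξ‖ := by gcongr
    _ = K * ((1 + r ^ 4) * ‖fourierL2 F ξ‖) := by ring
    _ ≤ K * (2 * (decayThird ξ * h2Density F ξ)) := by gcongr
    _ = _ := by ring

section fields

variable {M K : ℝ} {F : ℝ → ℝ} {j : ℕ}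

theorem integrable_fieldTransform (hK : 0 ≤ K) (hb : SymbolBound M K)
    (hF : eLpNorm (h2Density F) 2 volume < ∞) (hj : j ≤ 2) (y : ℝ) :
    Integrable (fieldTransform M F j y) :=
  ((integrable_decay_mul hF).const_mul (2 * K)).mono'
    (measurable_fieldTransform M F j y).aestronglyMeasurable
    (ae_of_all _ (norm_fieldTransform_le hK hb F hj y))

theorem integrable_deriv_fieldTransform (hK : 0 ≤ K) (hb : SymbolBound M K)
    (hF : eLpNorm (h2Density F) 2 volume < ∞) (y : ℝ) :
    Integrable fun ξ : ℝ => I * (2 * Real.pi * ξ : ℝ) * fieldTransform M F 0 y ξ :=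
  ((integrable_decay_mul hF).const_mul (2 * K)).mono'
    ((by fun_prop : Measurable fun ξ : ℝ => I * ((2 * Real.pi * ξ : ℝ) : ℂ)).mul
      (measurable_fieldTransform M F 0 y)).aestronglyMeasurable
    (ae_of_all _ (norm_deriv_fieldTransform_le hK hb F y))

theorem memLp_fieldTransform (hK : 0 ≤ K) (hb : SymbolBound M K)
    (hF : eLpNorm (h2Density F) 2 volume < ∞) (hj : j ≤ 2) (y : ℝ) :
    MemLp (fieldTransform M F j y) 2 :=
  ((memLp_decay_mul hF).const_mul (2 * K)).mono'
    (measurable_fieldTransform M F j y).aestronglyMeasurable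
    (ae_of_all _ (norm_fieldTransform_le hK hb F hj y))

theorem isHermitianAE_fieldTransform (hF2 : MemLp F 2)
    (hF : eLpNorm (h2Density F) 2 volume < ∞) (y : ℝ) :
    IsHermitianAE (fieldTransform M F j y) := by
  filter_upwards [isHermitianAE_fourierL2 hF2 (integrable_fourierL2 hF)] with ξ hξ
  rw [fieldTransform, fieldTransform, mul_neg, fieldSymbol_neg, hξ, map_mul]

theorem continuous_fieldTransform (ξ : ℝ) : Continuous fun y => fieldTransform M F j y ξ :=
  ((continuous_fieldSymbol M j _).comp (by fun_prop : Continuous fun y => max 0 (min M y))).mul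
    continuous_const

theorem continuous_field (hK : 0 ≤ K) (hb : SymbolBound M K)
    (hF : eLpNorm (h2Density F) 2 volume < ∞) (hj : j ≤ 2) :
    Continuous (Function.uncurry (field M F j)) :=
  continuous_realInv_param ((integrable_decay_mul hF).const_mul (2 * K))
    (fun y => (measurable_fieldTransform M F j y).aestronglyMeasurable)
    (fun y => ae_of_all _ (norm_fieldTransform_le hK hb F hj y))
    (ae_of_all _ fun ξ => continuous_fieldTransform ξ)

theorem memLp_field (hK : 0 ≤ K) (hb : SymbolBound M K)
    (hF : eLpNorm (h2Density F) 2 volume < ∞) (hj : j ≤ 2) (y : ℝ) :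
    MemLp (fun x => field M F j x y) 2 :=
  memLp_realInv (integrable_fieldTransform hK hb hF hj y) (memLp_fieldTransform hK hb hF hj y)

theorem fourierL2_field (hK : 0 ≤ K) (hb : SymbolBound M K) (hF2 : MemLp F 2)
    (hF : eLpNorm (h2Density F) 2 volume < ∞) (hj : j ≤ 2) (y : ℝ) :
    fourierL2 (fun x => field M F j x y) =ᵐ[volume] fieldTransform M F j y :=
  fourierL2_realInv (integrable_fieldTransform hK hb hF hj y) (memLp_fieldTransform hK hb hF hj y)
    (isHermitianAE_fieldTransform hF2 hF y)

theorem hasSymbolBound_field (hK : 0 ≤ K) (hb : SymbolBound M K) (hF2 : MemLp F 2)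
    (hF : eLpNorm (h2Density F) 2 volume < ∞) (hj : j ≤ 2) :
    HasSymbolBound M K j F (field M F j) where
  continuous := continuous_field hK hb hF hj
  memLp y _ := memLp_field hK hb hF hj y
  bound y hy := by
    filter_upwards [fourierL2_field hK hb hF2 hF hj y] with ξ hξ
    rw [hξ, fieldTransform_of_mem (Ioo_subset_Icc_self hy), norm_mul]
    gcongr
    exact hb j hj y hy.1.le _

theorem hasDerivWithinAt_fieldTransform_zero (ξ : ℝ) {y : ℝ} (hy : y ∈ Icc 0 M) :
    HasDerivWithinAt (fun y => fieldTransform M F 0 y ξ) (fieldTransform M F 1 y ξ) (Icc 0 M) y := by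
  rw [fieldTransform_of_mem hy]
  refine HasDerivWithinAt.congr_of_mem ?_ (fun t ht => fieldTransform_of_mem ht F 0 ξ) hy
  exact ((hasDerivAt_fieldSymbol_zero M y _).mul_const _).hasDerivWithinAt

theorem hasDerivWithinAt_fieldTransform_one (ξ : ℝ) {y : ℝ} (hy : y ∈ Icc 0 M) :
    HasDerivWithinAt (fun y => fieldTransform M F 1 y ξ) (fieldTransform M F 2 y ξ) (Icc 0 M) y := by
  rw [fieldTransform_of_mem hy]
  refine HasDerivWithinAt.congr_of_mem ?_ (fun t ht => fieldTransform_of_mem ht F 1 ξ) hy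
  exact ((hasDerivAt_fieldSymbol_one M y _).mul_const _).hasDerivWithinAt

theorem hasDerivWithinAt_field_zero (hK : 0 ≤ K) (hb : SymbolBound M K)
    (hF : eLpNorm (h2Density F) 2 volume < ∞) (x : ℝ) {y : ℝ} (hy : y ∈ Icc 0 M) :
    HasDerivWithinAt (field M F 0 x) (field M F 1 x y) (Icc 0 M) y :=
  hasDerivWithinAt_realInv_param (convex_Icc 0 M) ((integrable_decay_mul hF).const_mul (2 * K))
    (fun y _ => integrable_fieldTransform hK hb hF (by norm_num) y)
    (ae_of_all _ fun ξ _ hy => hasDerivWithinAt_fieldTransform_zero ξ hy)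
    (ae_of_all _ fun ξ y _ => norm_fieldTransform_le hK hb F (by norm_num) y ξ) x hy

theorem hasDerivWithinAt_field_one (hK : 0 ≤ K) (hb : SymbolBound M K)
    (hF : eLpNorm (h2Density F) 2 volume < ∞) (x : ℝ) {y : ℝ} (hy : y ∈ Icc 0 M) :
    HasDerivWithinAt (field M F 1 x) (field M F 2 x y) (Icc 0 M) y :=
  hasDerivWithinAt_realInv_param (convex_Icc 0 M) ((integrable_decay_mul hF).const_mul (2 * K))
    (fun y _ => integrable_fieldTransform hK hb hF (by norm_num) y)
    (ae_of_all _ fun ξ _ hy => hasDerivWithinAt_fieldTransform_one ξ hy)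
    (ae_of_all _ fun ξ y _ => norm_fieldTransform_le hK hb F le_rfl y ξ) x hy

theorem hasDerivAt_field_fst (hK : 0 ≤ K) (hb : SymbolBound M K)
    (hF : eLpNorm (h2Density F) 2 volume < ∞) (x y : ℝ) :
    HasDerivAt (fun x' => field M F 0 x' y)
      (realInv (fun ξ : ℝ => I * (2 * Real.pi * ξ : ℝ) * fieldTransform M F 0 y ξ) x) x :=
  hasDerivAt_realInv (integrable_fieldTransform hK hb hF (by norm_num) y)
    (integrable_deriv_fieldTransform hK hb hF y) x

theorem continuous_field_fst (hK : 0 ≤ K) (hb : SymbolBound M K)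
    (hF : eLpNorm (h2Density F) 2 volume < ∞) :
    Continuous (Function.uncurry fun x y =>
      realInv (fun ξ : ℝ => I * (2 * Real.pi * ξ : ℝ) * fieldTransform M F 0 y ξ) x) :=
  continuous_realInv_param (W := fun y ξ => I * (2 * Real.pi * ξ : ℝ) * fieldTransform M F 0 y ξ)
    ((integrable_decay_mul hF).const_mul (2 * K))
    (fun y => (integrable_deriv_fieldTransform hK hb hF y).aestronglyMeasurable)
    (fun y => ae_of_all _ (norm_deriv_fieldTransform_le hK hb F y))
    (ae_of_all _ fun ξ => continuous_const.mul (continuous_fieldTransform ξ))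

theorem mul_field_fst_eq (x : ℝ) {y : ℝ} (hy : y ∈ Icc 0 M) :
    y * realInv (fun ξ : ℝ => I * (2 * Real.pi * ξ : ℝ) * fieldTransform M F 0 y ξ) x
      = field M F 2 x y := by
  rw [← realInv_const_mul, field]
  congr 1
  funext ξ
  rw [fieldTransform_of_mem hy, fieldTransform_of_mem hy]
  simp only [fieldSymbol]
  ring

theorem eLpNorm_realInv {w : ℝ → ℂ} (hw : Integrable w) (hw2 : MemLp w 2)
    (hh : IsHermitianAE w) : eLpNorm (realInv w) 2 volume = eLpNorm w 2 volume := by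
  have h := lintegral_enorm_fourierL2 (memLp_realInv hw hw2)
  have e : ∫⁻ ξ, ‖fourierL2 (realInv w) ξ‖ₑ ^ 2 = ∫⁻ ξ, ‖w ξ‖ₑ ^ 2 := by
    refine lintegral_congr_ae ?_
    filter_upwards [fourierL2_realInv hw hw2 hh] with ξ hξ
    rw [hξ]
  rw [e, ← eLpNorm_two_sq, ← eLpNorm_two_sq] at h
  exact ((ENNReal.pow_right_strictMono two_ne_zero).injective h).symm

/-- `ω` is Lipschitz in `y` with values in `L²(ℝ)`, so it has a trace on the upper boundary. -/
theorem hasTrace_field (hM : 0 ≤ M) (hK : 0 ≤ K) (hb : SymbolBound M K) (hF2 : MemLp F 2)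
    (hF : eLpNorm (h2Density F) 2 volume < ∞) :
    HasTrace M (field M F 0) M (fun x => field M F 0 x M) := by
  refine ⟨field M F 0, EventuallyEq.rfl, ?_⟩
  have hMM : M ∈ Icc 0 M := ⟨hM, le_rfl⟩
  have hbound : ∀ y ∈ Ioo 0 M, eLpNorm (fun x => field M F 0 x y - field M F 0 x M) 2 volume
      ≤ ENNReal.ofReal (2 * K * |y - M|)
        * eLpNorm (fun ξ => decayThird ξ * h2Density F ξ) 2 volume := by
    intro y hy
    have hi := fun y => integrable_fieldTransform (j := 0) hK hb hF (by norm_num) y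
    have h2 := fun y => memLp_fieldTransform (j := 0) hK hb hF (by norm_num) y
    have hd : (fun x => field M F 0 x y - field M F 0 x M)
        = realInv (fun ξ => fieldTransform M F 0 y ξ - fieldTransform M F 0 M ξ) :=
      funext fun x => (realInv_sub (hi y) (hi M) x).symm
    rw [hd, eLpNorm_realInv (w := fun ξ => fieldTransform M F 0 y ξ - fieldTransform M F 0 M ξ)
      ((hi y).sub (hi M)) ((h2 y).sub (h2 M))]
    · refine eLpNorm_le_mul_eLpNorm_of_ae_le_mul (ae_of_all _ fun ξ => ?_) 2
      have hmv := (convex_Icc 0 M).norm_image_sub_le_of_norm_hasDerivWithin_le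
        (f := fun y => fieldTransform M F 0 y ξ) (f' := fun y => fieldTransform M F 1 y ξ)
        (fun y hy => hasDerivWithinAt_fieldTransform_zero ξ hy)
        (fun y _ => norm_fieldTransform_le hK hb F (by norm_num) y ξ) hMM (Ioo_subset_Icc_self hy)
      rw [Real.norm_of_nonneg (mul_nonneg (decayThird_nonneg ξ) (h2Density_nonneg F ξ))]
      refine hmv.trans (le_of_eq ?_)
      rw [Real.norm_eq_abs]
      ring
    · filter_upwards [isHermitianAE_fieldTransform (M := M) (j := 0) hF2 hF y,
        isHermitianAE_fieldTransform (M := M) (j := 0) hF2 hF M] with ξ a b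
      rw [a, b, map_sub]
  have hlim : Tendsto (fun y => ENNReal.ofReal (2 * K * |y - M|)
      * eLpNorm (fun ξ => decayThird ξ * h2Density F ξ) 2 volume) (𝓝[Ioo 0 M] M) (𝓝 0) := by
    have h1 : Tendsto (fun y => ENNReal.ofReal (2 * K * |y - M|)) (𝓝[Ioo 0 M] M) (𝓝 0) := by
      have h2 : Continuous fun y : ℝ => 2 * K * |y - M| := by fun_prop
      have h3 := (ENNReal.continuous_ofReal.comp h2).tendsto M
      simp only [Function.comp_apply, sub_self, abs_zero, mul_zero, ENNReal.ofReal_zero] at h3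
      exact h3.mono_left nhdsWithin_le_nhds
    have := ENNReal.Tendsto.mul_const (b := eLpNorm (fun ξ => decayThird ξ * h2Density F ξ) 2 volume)
      h1 (Or.inr (memLp_decay_mul hF).eLpNorm_ne_top)
    rwa [zero_mul] at this
  exact tendsto_of_tendsto_of_tendsto_of_le_of_le' tendsto_const_nhds hlim
    (Eventually.of_forall fun _ => zero_le) (eventually_of_mem self_mem_nhdsWithin hbound)

/-! ### The displacement -/

theorem measurable_displacementTransform : Measurable (displacementTransform M F) := by
  have h1 := measurable_fourierL2 F
  have h2 : Measurable fun ξ : ℝ => multM M (2 * Real.pi * ξ) :=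
    (measurable_multM M).comp (by fun_prop)
  unfold displacementTransform
  fun_prop

/-- The lower bound on the multiplier given by `exists_le_norm_multM`. -/
def MultiplierBound (M c : ℝ) : Prop := ∀ ξ : ℝ, c * (1 + |ξ| ^ (4 / 3 : ℝ)) ≤ ‖multM M ξ‖

theorem MultiplierBound.ne_zero {c : ℝ} (h : MultiplierBound M c) (hc : 0 < c) (ξ : ℝ) :
    multM M ξ ≠ 0 :=
  norm_pos_iff.1 (lt_of_lt_of_le (by positivity) (h ξ))

theorem norm_displacementTransform_le {c : ℝ} (hc : 0 < c) (hm : MultiplierBound M c) (ξ : ℝ) :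
    ‖displacementTransform M F ξ‖ ≤ c⁻¹ * ‖fourierL2 F ξ‖ := by
  have h1 : c ≤ ‖multM M (2 * Real.pi * ξ)‖ := by
    refine le_trans ?_ (hm _)
    have : 0 ≤ |2 * Real.pi * ξ| ^ (4 / 3 : ℝ) := by positivity
    nlinarith
  rw [displacementTransform, norm_div, norm_neg, div_eq_inv_mul]
  gcongr

theorem integrable_displacementTransform {c : ℝ} (hc : 0 < c) (hm : MultiplierBound M c)
    (hF : eLpNorm (h2Density F) 2 volume < ∞) : Integrable (displacementTransform M F) :=
  ((integrable_fourierL2 hF).norm.const_mul c⁻¹).mono'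
    measurable_displacementTransform.aestronglyMeasurable
    (ae_of_all _ (norm_displacementTransform_le hc hm))

theorem memLp_displacementTransform {c : ℝ} (hc : 0 < c) (hm : MultiplierBound M c) :
    MemLp (displacementTransform M F) 2 :=
  ((memLp_fourierL2 F).norm.const_mul c⁻¹).mono'
    measurable_displacementTransform.aestronglyMeasurable
    (ae_of_all _ (norm_displacementTransform_le hc hm))

theorem isHermitianAE_displacementTransform (hF2 : MemLp F 2)
    (hF : eLpNorm (h2Density F) 2 volume < ∞) : IsHermitianAE (displacementTransform M F) := by
  filter_upwards [isHermitianAE_fourierL2 hF2 (integrable_fourierL2 hF)] with ξ hξ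
  rw [displacementTransform, displacementTransform, mul_neg, multM_neg, hξ, map_div₀, map_neg]

/-- The weight `|ξ| ^ (5/3) (1 + ξ²) ^ (4/3 + α/2)` is absorbed by `|m| ^ 2` and four powers of the
frequency when `α ≤ 7/3`. -/
theorem weight_displacement_le {c α : ℝ} (hc : 0 < c) (hm : MultiplierBound M c)
    (hα : α ≤ 7 / 3) (ξ : ℝ) :
    (1 + (2 * Real.pi * ξ) ^ 2) ^ (4 / 3 + α / 2) * ((2 * Real.pi * |ξ|) ^ (5 / 6 : ℝ)) ^ 2
      * ‖displacementTransform M F ξ‖ ^ 2 ≤ (c⁻¹ * h2Density F ξ) ^ 2 := by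
  have habs : 2 * Real.pi * |ξ| = |2 * Real.pi * ξ| := by
    rw [abs_mul, abs_of_pos (by positivity : 0 < 2 * Real.pi)]
  have hmξ := hm (2 * Real.pi * ξ)
  rw [displacementTransform, h2Density, norm_div, norm_neg, habs]
  set η := 2 * Real.pi * ξ
  set X := 1 + η ^ 2 with hX
  have hX1 : 1 ≤ X := by nlinarith [sq_nonneg η]
  have hX0 : 0 < X := by linarith
  have h1 : (|η| ^ (5 / 6 : ℝ)) ^ 2 ≤ X ^ (5 / 6 : ℝ) := by
    calc (|η| ^ (5 / 6 : ℝ)) ^ 2 = (η ^ 2) ^ (5 / 6 : ℝ) := by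
          rw [← sq_abs η, ← Real.rpow_natCast, ← Real.rpow_natCast, ← Real.rpow_mul (abs_nonneg η),
            ← Real.rpow_mul (abs_nonneg η), mul_comm]
      _ ≤ _ := by gcongr; linarith
  have h2 : X ^ (2 / 3 : ℝ) ≤ 1 + |η| ^ (4 / 3 : ℝ) := by
    have := Real.rpow_add_le_add_rpow zero_le_one (sq_nonneg η) (p := 2 / 3) (by norm_num) (by norm_num)
    rw [Real.one_rpow, ← sq_abs, ← Real.rpow_natCast |η| 2, ← Real.rpow_mul (abs_nonneg η)] at this
    rw [hX, ← sq_abs, ← Real.rpow_natCast |η| 2]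
    convert this using 3
    norm_num
  have h3 : c * X ^ (2 / 3 : ℝ) ≤ ‖multM M η‖ := le_trans (by gcongr) hmξ
  have hm0 : 0 < c * X ^ (2 / 3 : ℝ) := by positivity
  have h4 : X ^ (4 / 3 + α / 2) * X ^ (5 / 6 : ℝ) ≤ X ^ 2 * (X ^ (2 / 3 : ℝ)) ^ 2 := by
    rw [← Real.rpow_natCast X 2, ← Real.rpow_natCast (X ^ (2 / 3 : ℝ)) 2, ← Real.rpow_mul hX0.le,
      ← Real.rpow_add hX0, ← Real.rpow_add hX0]
    refine Real.rpow_le_rpow_of_exponent_le hX1 ?_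
    push_cast
    linarith
  calc _ ≤ X ^ (4 / 3 + α / 2) * X ^ (5 / 6 : ℝ) * (‖fourierL2 F ξ‖ / (c * X ^ (2 / 3 : ℝ))) ^ 2 := by
        gcongr
    _ ≤ X ^ 2 * (X ^ (2 / 3 : ℝ)) ^ 2 * (‖fourierL2 F ξ‖ / (c * X ^ (2 / 3 : ℝ))) ^ 2 := by gcongr
    _ = _ := by field_simp

theorem eNormXinf_displacement_le {c α : ℝ} (hc : 0 < c) (hm : MultiplierBound M c)
    (hα : α ≤ 7 / 3) (hF2 : MemLp F 2) (hF : eLpNorm (h2Density F) 2 volume < ∞) :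
    eNormXinf α (realInv (displacementTransform M F))
      ≤ ENNReal.ofReal c⁻¹ * eLpNorm (h2Density F) 2 volume
        + ENNReal.ofReal (2 * c⁻¹) * (eLpNorm decayThird 2 volume * eLpNorm (h2Density F) 2 volume) := by
  have hi := integrable_displacementTransform hc hm hF
  rw [eNormXinf]
  refine add_le_add ?_ ?_
  · refine (iInf₂_le (displacementTransform M F) (isFourierOffZero_realInv hi
      (isHermitianAE_displacementTransform hF2 hF))).trans (rpow_half_le_of_le_sq ?_)
    rw [mul_pow, eLpNorm_two_sq,
      ← lintegral_const_mul _ ((measurable_h2Density F).enorm.pow_const 2)]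
    refine lintegral_mono fun ξ => ?_
    have := weight_displacement_le (F := F) hc hm hα ξ
    have e1 : ‖displacementTransform M F ξ‖ₑ ^ 2
        = ENNReal.ofReal (‖displacementTransform M F ξ‖ ^ 2) := by
      rw [ENNReal.ofReal_pow (norm_nonneg _), ofReal_norm]
    have e2 : ENNReal.ofReal c⁻¹ ^ 2 * ‖h2Density F ξ‖ₑ ^ 2
        = ENNReal.ofReal ((c⁻¹ * h2Density F ξ) ^ 2) := by
      rw [Real.enorm_of_nonneg (h2Density_nonneg F ξ), ← mul_pow,
        ← ENNReal.ofReal_mul (by positivity),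
        ENNReal.ofReal_pow (mul_nonneg (by positivity) (h2Density_nonneg F ξ))]
    rw [e1, e2, ← ENNReal.ofReal_mul (by positivity)]
    exact ENNReal.ofReal_le_ofReal this
  · have h1 : eLpNorm (realInv (displacementTransform M F)) ∞ volume
        ≤ ENNReal.ofReal (∫ ξ, ‖displacementTransform M F ξ‖) := by
      rw [eLpNorm_exponent_top]
      refine eLpNormEssSup_le_of_ae_enorm_bound (ae_of_all _ fun x => ?_)
      rw [← ofReal_norm]
      exact ENNReal.ofReal_le_ofReal (norm_realInv_le _ x)
    refine h1.trans ?_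
    rw [ofReal_integral_norm_eq_lintegral_enorm hi]
    refine le_trans ?_ (mul_le_mul_right (lintegral_decay_mul_le F) _)
    have hmeas : Measurable fun ξ => ‖decayThird ξ * h2Density F ξ‖ₑ := by
      have := measurable_h2Density F
      unfold decayThird
      fun_prop
    rw [← lintegral_const_mul _ hmeas]
    refine lintegral_mono fun ξ => ?_
    have hnn := mul_nonneg (decayThird_nonneg ξ) (h2Density_nonneg F ξ)
    rw [← ofReal_norm, Real.enorm_of_nonneg hnn, ← ENNReal.ofReal_mul (by positivity)]
    refine ENNReal.ofReal_le_ofReal ((norm_displacementTransform_le hc hm ξ).trans ?_)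
    have h2 : ‖fourierL2 F ξ‖ ≤ 2 * (decayThird ξ * h2Density F ξ) := by
      refine le_trans ?_ (norm_fourierL2_le F ξ)
      have : 0 ≤ (|2 * Real.pi * ξ| ^ (1 / 3 : ℝ)) ^ 4 := by positivity
      nlinarith [norm_nonneg (fourierL2 F ξ)]
    calc c⁻¹ * ‖fourierL2 F ξ‖ ≤ c⁻¹ * (2 * (decayThird ξ * h2Density F ξ)) := by gcongr
      _ = _ := by ring

/-- Conservation of mass across the strip. -/
theorem integral_field_eq {c : ℝ} (hc : 0 < c) (hm : MultiplierBound M c) (hM : 0 ≤ M) (hK : 0 ≤ K)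
    (hb : SymbolBound M K) (hF2 : MemLp F 2) (hF : eLpNorm (h2Density F) 2 volume < ∞) :
    ∀ᵐ x : ℝ, ∫ y in (0 : ℝ)..M, field M F 0 x y = realInv (displacementTransform M F) x + F x := by
  have hia := integrable_displacementTransform hc hm hF
  have hif := integrable_fourierL2 hF
  filter_upwards [ae_eq_realInv_fourierL2 hF2 hif] with x hx
  have hFx : F x = realInv (fourierL2 F) x := by rw [realInv, ← hx, ofReal_re]
  have h1 := intervalIntegral_realInv (a := 0) (b := M) ((integrable_decay_mul hF).const_mul (2 * K))
    (measurable_uncurry_fieldTransform M F 0)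
    (fun y ξ => norm_fieldTransform_le hK hb F (by norm_num) y ξ) x
  have h2 : (fun ξ => ∫ y in (0 : ℝ)..M, fieldTransform M F 0 y ξ)
      = fun ξ => displacementTransform M F ξ + fourierL2 F ξ := by
    funext ξ
    have e : ∫ y in (0 : ℝ)..M, fieldTransform M F 0 y ξ
        = ∫ y in (0 : ℝ)..M, symbolOmega M y (2 * Real.pi * ξ) * fourierL2 F ξ := by
      refine intervalIntegral.integral_congr fun y hy => ?_
      rw [uIcc_of_le hM] at hy
      exact fieldTransform_of_mem hy F 0 ξ
    rw [e, intervalIntegral.integral_mul_const, integral_symbolOmega M _ (hm.ne_zero hc _),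
      displacementTransform]
    ring
  have h3 := realInv_sub (hia.add hif) hia x
  have h4 : (fun ξ => (displacementTransform M F + fourierL2 F) ξ - displacementTransform M F ξ)
      = fourierL2 F := by
    funext ξ; simp
  rw [h4] at h3
  have h5 : ∫ y in (0 : ℝ)..M, field M F 0 x y
      = realInv (displacementTransform M F + fourierL2 F) x := by
    rw [show (displacementTransform M F + fourierL2 F)
      = fun ξ => displacementTransform M F ξ + fourierL2 F ξ from rfl, ← h2, ← h1]
    rfl
  rw [h5, hFx, h3]
  ring

theorem isSolution_field {c : ℝ} (hc : 0 < c) (hm : MultiplierBound M c) (hM : 0 ≤ M) (hK : 0 ≤ K)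
    (hb : SymbolBound M K) (hF2 : MemLp F 2) (hF : eLpNorm (h2Density F) 2 volume < ∞) :
    IsSolution M F (field M F 0) (realInv (displacementTransform M F)) := by
  refine ⟨fun x y => realInv (fun ξ : ℝ => I * (2 * Real.pi * ξ : ℝ) * fieldTransform M F 0 y ξ) x,
    field M F 1, field M F 2,
    ⟨(continuous_field hK hb hF (by norm_num)).continuousOn,
      (continuous_field_fst hK hb hF).continuousOn,
      (continuous_field hK hb hF (by norm_num)).continuousOn,
      (continuous_field hK hb hF le_rfl).continuousOn⟩,
    fun x y hy => ⟨hasDerivAt_field_fst hK hb hF x y, hasDerivWithinAt_field_zero hK hb hF x hy,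
      hasDerivWithinAt_field_one hK hb hF x hy, sub_eq_zero.2 (mul_field_fst_eq x hy)⟩,
    ⟨memLp_field hK hb hF (by norm_num) 0, displacementTransform M F,
      isFourierOffZero_realInv (integrable_displacementTransform hc hm hF)
        (isHermitianAE_displacementTransform hF2 hF), ?_⟩,
    integral_field_eq hc hm hM hK hb hF2 hF⟩
  filter_upwards [fourierL2_field (j := 1) hK hb hF2 hF (by norm_num) 0] with ξ hξ
  rw [hξ, fieldTransform_of_mem ⟨le_rfl, hM⟩, fieldSymbol_one_zero, displacementTransform]
  ring

theorem isExplicit_field {c : ℝ} (hc : 0 < c) (hm : MultiplierBound M c) (hK : 0 ≤ K)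
    (hb : SymbolBound M K) (hF2 : MemLp F 2) (hF : eLpNorm (h2Density F) 2 volume < ∞) :
    IsExplicit M F (field M F 0) (realInv (displacementTransform M F)) where
  memLp_A := memLp_realInv (integrable_displacementTransform hc hm hF)
    (memLp_displacementTransform hc hm)
  fourier_A := fourierL2_realInv (integrable_displacementTransform hc hm hF)
    (memLp_displacementTransform hc hm) (isHermitianAE_displacementTransform hF2 hF)
  memLp_ω y _ := memLp_field hK hb hF (by norm_num) y
  fourier_ω y hy := by
    filter_upwards [fourierL2_field (j := 0) hK hb hF2 hF (by norm_num) y] with ξ hξ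
    rw [hξ, fieldTransform_of_mem hy, fieldSymbol]

theorem trace_field {c : ℝ} (hc : 0 < c) (hm : MultiplierBound M c) (hM : 0 ≤ M) (hK : 0 ≤ K)
    (hb : SymbolBound M K) (hF2 : MemLp F 2) (hF : eLpNorm (h2Density F) 2 volume < ∞) :
    ∃ g : ℝ → ℝ, HasTrace M (field M F 0) M g ∧
      IsMultiplier
        (fun ξ => airyAi (M * symbolD (1 / 3) ξ) / airyDerivZero
          * symbolD (2 / 3) ξ * ((|ξ| : ℝ) : ℂ)) (realInv (displacementTransform M F)) g := by
  refine ⟨fun x => field M F 0 x M, hasTrace_field hM hK hb hF2 hF,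
    memLp_field hK hb hF (by norm_num) M, displacementTransform M F,
      isFourierOffZero_realInv (integrable_displacementTransform hc hm hF)
        (isHermitianAE_displacementTransform hF2 hF), ?_⟩
  filter_upwards [fourierL2_field (j := 0) hK hb hF2 hF (by norm_num) M] with ξ hξ
  rw [hξ, fieldTransform_of_mem ⟨hM, le_rfl⟩, fieldSymbol, symbolOmega_eq, displacementTransform]
  ring

theorem eNormX0X_field_le {α : ℝ} (hα0 : 0 ≤ α) (hα : α ≤ 7 / 3) (hM : 0 ≤ M) (hK : 0 ≤ K)
    (hb : SymbolBound M K) (hF2 : MemLp F 2) (hF : eLpNorm (h2Density F) 2 volume < ∞) :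
    eNormX0X M α (field M F 0)
      ≤ 14 * (ENNReal.ofReal (4 * K) * eLpNorm (h2Density F) 2 volume) := by
  have h : ∀ a : ℝ, 0 ≤ a → a ≤ 7 / 3 → eNormX M a (field M F 0)
      ≤ 7 * (ENNReal.ofReal (4 * K) * eLpNorm (h2Density F) 2 volume) := fun a h0 h1 =>
    eNormX_le hK h0 h1 hF (hasSymbolBound_field hK hb hF2 hF (by norm_num))
      (hasSymbolBound_field hK hb hF2 hF (by norm_num)) (hasSymbolBound_field hK hb hF2 hF le_rfl)
      (isWeakDy_one hM (continuous_field hK hb hF (by norm_num))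
        (continuous_field hK hb hF (by norm_num))
        fun x y hy => hasDerivWithinAt_field_zero hK hb hF x hy)
      (isWeakDy_two hM (continuous_field hK hb hF (by norm_num))
        (continuous_field hK hb hF (by norm_num)) (continuous_field hK hb hF le_rfl)
        (fun x y hy => hasDerivWithinAt_field_zero hK hb hF x hy)
        fun x y hy => hasDerivWithinAt_field_one hK hb hF x hy)
  rw [eNormX0X]
  refine (add_le_add (h 0 le_rfl (by norm_num)) (h α hα0 hα)).trans (le_of_eq ?_)
  ring

end fields

end TripleDeck

theorem theorem1p1 :
    ∃ M₀ : ℝ, 0 < M₀ ∧ ∃ C : ℝ, 0 < C ∧ ∀ M : ℝ, M₀ ≤ M →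
      (∀ ξ : ℝ, multM M ξ ≠ 0) ∧
      ∀ α : ℝ, 0 < α → α ≤ 7 / 3 → ∀ F : ℝ → ℝ, eNormH 2 F < ∞ →
        ∃ (ω₀ : ℝ → ℝ → ℝ) (A₀ : ℝ → ℝ),
          IsSolution M F ω₀ A₀ ∧ MemCalX α M ω₀ A₀ ∧ IsExplicit M F ω₀ A₀ ∧
          eNormX0X M α ω₀ + eNormXinf α A₀ ≤ ENNReal.ofReal C * eNormH 2 F := by
  obtain ⟨M₀, hM₀, c, hc, hm⟩ := exists_le_norm_multM
  obtain ⟨K, hK, hsym⟩ := exists_norm_fieldSymbol_le hc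
  set E : ℝ := (eLpNorm decayThird 2 volume).toReal with hE
  have hE0 : 0 ≤ E := ENNReal.toReal_nonneg
  refine ⟨M₀, hM₀, 14 * (4 * K) + c⁻¹ + 2 * c⁻¹ * E, by positivity, fun M hM => ?_⟩
  have hM0 : 0 ≤ M := hM₀.le.trans hM
  have hmb : MultiplierBound M c := hm M hM
  have hb : SymbolBound M K := hsym M hmb
  refine ⟨hmb.ne_zero hc, fun α hα0 hα F hFH => ?_⟩
  have hF2 := memLp_of_eNormH_lt_top hFH
  have hN := eLpNorm_h2Density hF2
  have hF : eLpNorm (h2Density F) 2 volume < ∞ := hN ▸ hFH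
  have hbound : eNormX0X M α (field M F 0) + eNormXinf α (realInv (displacementTransform M F))
      ≤ ENNReal.ofReal (14 * (4 * K) + c⁻¹ + 2 * c⁻¹ * E) * eNormH 2 F := by
    refine (add_le_add (eNormX0X_field_le hα0.le hα hM0 hK.le hb hF2 hF)
      (eNormXinf_displacement_le hc hmb hα hF2 hF)).trans (le_of_eq ?_)
    have hEo : eLpNorm decayThird 2 volume = ENNReal.ofReal E :=
      (ENNReal.ofReal_toReal memLp_decayThird.eLpNorm_ne_top).symm
    have h14 : (14 : ℝ≥0∞) = ENNReal.ofReal 14 := by norm_num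
    rw [hN, hEo, h14, ENNReal.ofReal_add (by positivity) (by positivity),
      ENNReal.ofReal_add (by positivity) (by positivity),
      ENNReal.ofReal_mul (p := 14) (by norm_num),
      ENNReal.ofReal_mul (p := 2 * c⁻¹) (by positivity)]
    ring
  refine ⟨field M F 0, realInv (displacementTransform M F),
    isSolution_field hc hmb hM0 hK.le hb hF2 hF,
    ⟨hbound.trans_lt (ENNReal.mul_lt_top ENNReal.ofReal_lt_top hFH),
      trace_field hc hmb hM0 hK.le hb hF2 hF⟩,
    isExplicit_field hc hmb hK.le hb hF2 hF, hbound⟩
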